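/- All graphs are finite and simple; $C_k$ ($k\ge 3$) denotes the cycle of length $k$, and cycles are considered up to isomorphism. For a nonnegative integer $D$, a graph is $(D,D)$-colorable if its vertex set can be partitioned into two (possibly empty) parts, each inducing a subgraph of maximum degree at most $D$. A set $S$ of cycles is called a cycle obstruction set of balanced $2$-partitionable planar graphs if there is a nonnegative integer $D$ such that every planar graph containing no member of $S$ as a (not necessarily induced) subgraph is $(D,D)$-colorable. Theorem. Let $S$ be a set of cycles. Then $S$ is a cycle obstruction set of balanced $2$-partitionable planar graphs if and only if $C_4\in S$ or $S$ contains all odd cycles. Consequently, the inclusion-wise minimal cycle obstruction sets of balanced $2$-partitionable planar graphs are exactly $\{C_4\}$ and $\{C_{2i+1} : i\ge 1\}$. -/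

import Mathlib

namespace ImproperColoring

/-- The Euclidean plane; only its affine structure is used below. -/
abbrev Plane : Type := ℝ × ℝ

/-- `A` is a simple polygonal arc from `x` to `y`: the union of the segments
`[q 0, q 1], [q 1, q 2], …, [q n, q (n + 1)]`, all of positive length, where `q 0 = x`,
`q (n + 1) = y`, consecutive segments meet only in their common endpoint, and non-consecutive
segments are disjoint. -/
def IsPolygonalArc (A : Set Plane) (x y : Plane) : Prop :=
  ∃ (n : ℕ) (q : ℕ → Plane),
    q 0 = x ∧ q (n + 1) = y ∧
    A = ⋃ i ∈ Set.Iic n, segment ℝ (q i) (q (i + 1)) ∧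
    (∀ i ≤ n, q i ≠ q (i + 1)) ∧
    (∀ i < n, segment ℝ (q i) (q (i + 1)) ∩ segment ℝ (q (i + 1)) (q (i + 2)) = {q (i + 1)}) ∧
    (∀ i j, i + 1 < j → j ≤ n →
      Disjoint (segment ℝ (q i) (q (i + 1))) (segment ℝ (q j) (q (j + 1))))

/-- An embedding of the graph `G` in the plane: distinct vertices are distinct points, each edge
is an arc joining its two ends, and the interior of an edge (the arc without its two ends)
contains no vertex and no point of any other edge. -/
structure PlaneEmbedding {V : Type} (G : SimpleGraph V) where
  point : V → Plane
  point_injective : Function.Injective point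
  arc : Sym2 V → Set Plane
  isPolygonalArc : ∀ u v, G.Adj u v → IsPolygonalArc (arc s(u, v)) (point u) (point v)
  interior_disjoint_vertices : ∀ e ∈ G.edgeSet,
    Disjoint (arc e \ point '' {w | w ∈ e}) (Set.range point)
  interior_disjoint_edges : ∀ e ∈ G.edgeSet, ∀ f ∈ G.edgeSet, e ≠ f →
    Disjoint (arc e \ point '' {w | w ∈ e}) (arc f)

/-- A graph is planar if it can be embedded in the plane. -/
def IsPlanar {V : Type} (G : SimpleGraph V) : Prop :=
  Nonempty (PlaneEmbedding G)

/-- `G` is `(d 0, …, d (k - 1))`-colorable: the vertices can be partitioned into `k` (possibly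
empty) color classes such that the `i`-th class induces a graph of maximum degree at most `d i`. -/
def IsDefectiveColorable {V : Type} [Finite V] (G : SimpleGraph V) {k : ℕ} (d : Fin k → ℕ) :
    Prop :=
  ∃ c : V → Fin k, ∀ (i : Fin k) (v : {v | c v = i}),
    ((G.induce {v | c v = i}).neighborSet v).ncard ≤ d i

/-- A class of finite simple graphs. -/
abbrev GraphClass : Type 1 :=
  ∀ (V : Type) [Finite V], SimpleGraph V → Prop

/-- A class of graphs is balanced `k`-partitionable if there is a single `D` such that all its
members are `(D, …, D)`-colorable, where the tuple has length `k`. -/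
def IsBalancedPartitionable (k : ℕ) (C : GraphClass) : Prop :=
  ∃ D : ℕ, ∀ (V : Type) [Finite V] (G : SimpleGraph V),
    C V G → IsDefectiveColorable G (fun _ : Fin k => D)

/-- Cycles up to isomorphism: the number `k ≥ 3` stands for the cycle `C_k` of length `k`. -/
abbrev CycleLength : Type := {k : ℕ // 3 ≤ k}

/-- The class of planar graphs that contain no cycle in `S` as a (not necessarily induced)
subgraph. -/
def planarAvoiding (S : Set CycleLength) : GraphClass :=
  fun _ _ G => IsPlanar G ∧ ∀ k ∈ S, ¬ (SimpleGraph.cycleGraph k.1).IsContained G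

/-- `S` is a cycle obstruction set of balanced `k`-partitionable planar graphs: the planar graphs
that contain no cycle in `S` form a balanced `k`-partitionable class. -/
def IsBalancedObstructionSet (k : ℕ) (S : Set CycleLength) : Prop :=
  IsBalancedPartitionable k (planarAvoiding S)

/-- The cycle `C_4`. -/
def fourCycle : CycleLength := ⟨4, by norm_num⟩

/-- The set of all odd cycles. -/
def oddCycles : Set CycleLength := {k | Odd k.1}

end ImproperColoring

/-! Sufficiency. A graph without odd cycles is bipartite, so `D = 0` works. Without `C_4`, `D = 272`
works by induction on the number of edges (`WeaklyPlanar.exists_hasDefect`): a vertex of degree one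
can be coloured against its only neighbour, and otherwise some edge has two ends of degree at most
272 (`WeaklyPlanar.exists_light_edge`), so that restoring it does no harm. If there were no such
light edge, the vertices of small degree would have only neighbours of large degree. Joining two
neighbours of each small vertex gives a planar graph on the large ones, and since there is no `C_4`,
different small vertices give different pairs. Sparsity of this graph bounds the number of small
vertices, and sparsity of the original graph then contradicts the large degrees.

Sparsity is proved without Euler's formula. Only weak planarity is used: edges without a common end
are drawn disjointly. This survives contraction for trivial reasons, since concatenated curves need
no rerouting. `K_5` is not weakly planar (`not_weaklyPlanar_top_five`): for polygonal drawings in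
general position, the parity of the number of crossings between edges without a common end does not
change when the edges are straightened, and the straight drawing has odd parity; a small
perturbation supplies general position. An argument in the style of Mader (`IsDensityBound.double`)
turns the exclusion of `K_5` under contraction into a linear bound on the number of edges.

Necessity. If `C_4` and `C_{2r+1}` are both missing from `S`, the graph `necklace r D` is planar,
has cycles of these two lengths only, and is not `(D, D)`-colorable. Copies of `K_{2,2D+1}` force
all beads to have the colour of the root, which is adjacent to `D + 1` last beads. -/

namespace ImproperColoring

/-! ### Orientations and crossings -/

/-- Twice the signed area of the triangle `a b c`. -/
def orient (a b c : Plane) : ℝ :=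
  (b.1 - a.1) * (c.2 - a.2) - (b.2 - a.2) * (c.1 - a.1)

/-- The sign of the orientation of a triangle. -/
noncomputable def orientSign (a b c : Plane) : Bool := decide (0 < orient a b c)

/-- The segments `a b` and `c d` cross, for points in general position. -/
noncomputable def crosses (a b c d : Plane) : Bool :=
  (orientSign a b c ^^ orientSign a b d) && (orientSign c d a ^^ orientSign c d b)

/-- The point `d` lies in the triangle `a b c`, for points in general position. -/
noncomputable def insideTriangle (a b c d : Plane) : Bool :=
  (orientSign a b d == orientSign b c d) && (orientSign b c d == orientSign c a d)

theorem orientSign_rotate (a b c : Plane) : orientSign b c a = orientSign a b c := by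
  unfold orientSign orient
  congr 2
  ring

theorem orientSign_swap {a b c : Plane} (h : orient a b c ≠ 0) :
    orientSign b a c = !orientSign a b c := by
  have : orient b a c = -orient a b c := by unfold orient; ring
  unfold orientSign
  rw [this]
  rcases lt_or_gt_of_ne h with h | h
  · simp [h, h.le]
  · simp [h, h.le]

theorem orientSign_swap_right {a b c : Plane} (h : orient a b c ≠ 0) :
    orientSign a c b = !orientSign a b c := by
  rw [← orientSign_swap h, ← orientSign_rotate b a c]

theorem crosses_comm (a b c d : Plane) : crosses a b c d = crosses c d a b := by
  unfold crosses
  rw [Bool.and_comm]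

theorem segment_inter_of_crosses {a b c d : Plane} (h : crosses a b c d = true)
    (h1 : orient a b c ≠ 0) (h2 : orient a b d ≠ 0) (h3 : orient c d a ≠ 0)
    (h4 : orient c d b ≠ 0) : ∃ z, z ∈ segment ℝ a b ∧ z ∈ segment ℝ c d := by
  have key : ∀ x y : ℝ, x ≠ 0 → y ≠ 0 → (decide (0 < x) ^^ decide (0 < y)) = true →
      x - y ≠ 0 ∧ 0 ≤ x / (x - y) ∧ 0 ≤ - y / (x - y) := by
    intro x y hx hy hxy
    rcases lt_or_gt_of_ne hx with hx | hx <;> rcases lt_or_gt_of_ne hy with hy | hy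
    · simp [hx.not_gt, hy.not_gt] at hxy
    · refine ⟨by linarith, div_nonneg_of_nonpos hx.le (by linarith),
        div_nonneg_of_nonpos (by linarith) (by linarith)⟩
    · refine ⟨by linarith, div_nonneg hx.le (by linarith),
        div_nonneg (by linarith) (by linarith)⟩
    · simp [hx, hy] at hxy
  unfold crosses orientSign at h
  rw [Bool.and_eq_true] at h
  obtain ⟨hu0, hu1, hu2⟩ := key _ _ h1 h2 h.1
  obtain ⟨ht0, ht1, ht2⟩ := key _ _ h3 h4 h.2
  refine ⟨(-orient c d b / (orient c d a - orient c d b)) • a +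
      (orient c d a / (orient c d a - orient c d b)) • b, ?_, ?_⟩
  · exact ⟨_, _, ht2, ht1, by field_simp; ring, rfl⟩
  · refine ⟨-orient a b d / (orient a b c - orient a b d),
      orient a b c / (orient a b c - orient a b d), hu2, hu1, by field_simp; ring, ?_⟩
    -- Both differences are, up to sign, the cross product of `b - a` and `d - c`, so the two
    -- parametrizations of the intersection point have a common denominator.
    have e : orient c d a - orient c d b = - (orient a b c - orient a b d) := by
      unfold orient; ring
    have ht0' := ht0
    rw [e] at ht0' ⊢
    ext
    · simp only [Prod.fst_add, Prod.smul_fst, smul_eq_mul]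
      field_simp
      unfold orient
      ring
    · simp only [Prod.snd_add, Prod.smul_snd, smul_eq_mul]
      field_simp
      unfold orient
      ring

/-- Sign consequence of the three-term Grassmann–Plücker relation. -/
def PluckerSigns (x₁ x₂ y₁ y₂ z₁ z₂ : Bool) : Bool :=
  !(((x₁ == x₂) == (z₁ == z₂)) && ((x₁ == x₂) == (y₁ ^^ y₂)))

/-- Sign consequence of the affine relation between four points. -/
def AffineSigns (x y z w : Bool) : Bool :=
  !((x == z) && (y == w) && (x ^^ y))

/-- Three nonzero reals with sum zero, here `x₁ * x₂`, `-(y₁ * y₂)` and `z₁ * z₂`, cannot all have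
the same sign. -/
theorem pluckerSigns_of_eq {x₁ x₂ y₁ y₂ z₁ z₂ : ℝ} (hx₁ : x₁ ≠ 0) (hx₂ : x₂ ≠ 0)
    (hy₁ : y₁ ≠ 0) (hy₂ : y₂ ≠ 0) (hz₁ : z₁ ≠ 0) (hz₂ : z₂ ≠ 0)
    (h : x₁ * x₂ - y₁ * y₂ + z₁ * z₂ = 0) :
    PluckerSigns (decide (0 < x₁)) (decide (0 < x₂)) (decide (0 < y₁)) (decide (0 < y₂))
      (decide (0 < z₁)) (decide (0 < z₂)) = true := by
  have sgn : ∀ {x y : ℝ}, x ≠ 0 → y ≠ 0 →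
      (decide (0 < x) == decide (0 < y)) = decide (0 < x * y) := by
    intro x y hx hy
    rcases lt_or_gt_of_ne hx with hx | hx <;> rcases lt_or_gt_of_ne hy with hy | hy
    · simp [hx.not_gt, hy.not_gt, mul_pos_of_neg_of_neg hx hy]
    · simp [hx.not_gt, hy, (mul_neg_of_neg_of_pos hx hy).not_gt]
    · simp [hx, hy.not_gt, (mul_neg_of_pos_of_neg hx hy).not_gt]
    · simp [hx, hy, mul_pos hx hy]
  have sgn' : (decide (0 < y₁) ^^ decide (0 < y₂)) = !decide (0 < y₁ * y₂) := by
    rw [← sgn hy₁ hy₂]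
    cases decide (0 < y₁) <;> cases decide (0 < y₂) <;> rfl
  unfold PluckerSigns
  rw [sgn hx₁ hx₂, sgn hz₁ hz₂, sgn']
  have hx := mul_ne_zero hx₁ hx₂
  have hy := mul_ne_zero hy₁ hy₂
  have hz := mul_ne_zero hz₁ hz₂
  rcases lt_or_gt_of_ne hx with hx | hx <;> rcases lt_or_gt_of_ne hy with hy | hy <;>
    rcases lt_or_gt_of_ne hz with hz | hz <;>
    simp [hx, hy, hz, hx.not_gt, hy.not_gt, hz.not_gt] <;> linarith

theorem affineSigns_of_eq {x y z w : ℝ} (hx : x ≠ 0) (hy : y ≠ 0) (hz : z ≠ 0) (hw : w ≠ 0)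
    (h : x - y + z - w = 0) :
    AffineSigns (decide (0 < x)) (decide (0 < y)) (decide (0 < z)) (decide (0 < w)) = true := by
  unfold AffineSigns
  rcases lt_or_gt_of_ne hx with hx | hx <;> rcases lt_or_gt_of_ne hy with hy | hy <;>
    rcases lt_or_gt_of_ne hz with hz | hz <;> rcases lt_or_gt_of_ne hw with hw | hw <;>
    simp [hx, hy, hz, hw, hx.not_gt, hy.not_gt, hz.not_gt, hw.not_gt] <;> linarith

/-- The sign relations that hold for five points in general position. The ten signs are those of
the triples in lexicographic order. -/
def FiveSigns (abc abd abe acd ace ade bcd bce bde cde : Bool) : Bool :=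
  PluckerSigns abc ade abd ace abe acd && PluckerSigns abc bde abd bce abe bcd &&
  PluckerSigns abc cde acd bce ace bcd && PluckerSigns abd cde acd bde ade bcd &&
  PluckerSigns abe cde ace bde ade bce &&
  AffineSigns abc abd acd bcd && AffineSigns abc abe ace bce && AffineSigns abd abe ade bde &&
  AffineSigns acd ace ade cde && AffineSigns bcd bce bde cde

/-- Crossing and containment depend only on the ten orientation signs, so the claim is a check of
1024 patterns. The negated signs come from writing the triple `c a d` in lexicographic order. -/
theorem triangle_signs_table : ∀ abc abd abe acd ace ade bcd bce bde cde : Bool,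
    FiveSigns abc abd abe acd ace ade bcd bce bde cde = true →
    (((abd ^^ abe) && (ade ^^ bde)) ^^ ((bcd ^^ bce) && (bde ^^ cde)) ^^
      ((!acd ^^ !ace) && (cde ^^ ade))) =
    (((abd == bcd) && (bcd == !acd)) ^^ ((abe == bce) && (bce == !ace))) := by
  decide +kernel

/-- Each of the five blocks collects the three ways to split four of the points into two segments;
together they are the fifteen pairs of disjoint edges of `K_5`. -/
theorem five_signs_table : ∀ abc abd abe acd ace ade bcd bce bde cde : Bool,
    FiveSigns abc abd abe acd ace ade bcd bce bde cde = true →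
    ((((abc ^^ abd) && (acd ^^ bcd)) ^^ ((!abc ^^ acd) && (abd ^^ !bcd)) ^^
        ((!abd ^^ !acd) && (abc ^^ bcd))) ^^
      (((abc ^^ abe) && (ace ^^ bce)) ^^ ((!abc ^^ ace) && (abe ^^ !bce)) ^^
        ((!abe ^^ !ace) && (abc ^^ bce))) ^^
      (((abd ^^ abe) && (ade ^^ bde)) ^^ ((!abd ^^ ade) && (abe ^^ !bde)) ^^
        ((!abe ^^ !ade) && (abd ^^ bde))) ^^
      (((acd ^^ ace) && (ade ^^ cde)) ^^ ((!acd ^^ ade) && (ace ^^ !cde)) ^^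
        ((!ace ^^ !ade) && (acd ^^ cde))) ^^
      (((bcd ^^ bce) && (bde ^^ cde)) ^^ ((!bcd ^^ bde) && (bce ^^ !cde)) ^^
        ((!bce ^^ !bde) && (bcd ^^ cde)))) = true := by
  decide +kernel

/-- No three of the five points are collinear. -/
structure FiveGeneric (a b c d e : Plane) : Prop where
  abc : orient a b c ≠ 0
  abd : orient a b d ≠ 0
  abe : orient a b e ≠ 0
  acd : orient a c d ≠ 0
  ace : orient a c e ≠ 0
  ade : orient a d e ≠ 0
  bcd : orient b c d ≠ 0
  bce : orient b c e ≠ 0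
  bde : orient b d e ≠ 0
  cde : orient c d e ≠ 0

theorem FiveGeneric.fiveSigns {a b c d e : Plane} (h : FiveGeneric a b c d e) :
    FiveSigns (orientSign a b c) (orientSign a b d) (orientSign a b e) (orientSign a c d)
      (orientSign a c e) (orientSign a d e) (orientSign b c d) (orientSign b c e)
      (orientSign b d e) (orientSign c d e) = true := by
  unfold FiveSigns orientSign
  simp only [Bool.and_eq_true]
  refine ⟨⟨⟨⟨⟨⟨⟨⟨⟨?_, ?_⟩, ?_⟩, ?_⟩, ?_⟩, ?_⟩, ?_⟩, ?_⟩, ?_⟩, ?_⟩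
  · exact pluckerSigns_of_eq h.abc h.ade h.abd h.ace h.abe h.acd (by unfold orient; ring)
  · exact pluckerSigns_of_eq h.abc h.bde h.abd h.bce h.abe h.bcd (by unfold orient; ring)
  · exact pluckerSigns_of_eq h.abc h.cde h.acd h.bce h.ace h.bcd (by unfold orient; ring)
  · exact pluckerSigns_of_eq h.abd h.cde h.acd h.bde h.ade h.bcd (by unfold orient; ring)
  · exact pluckerSigns_of_eq h.abe h.cde h.ace h.bde h.ade h.bce (by unfold orient; ring)
  · exact affineSigns_of_eq h.abc h.abd h.acd h.bcd (by unfold orient; ring)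
  · exact affineSigns_of_eq h.abc h.abe h.ace h.bce (by unfold orient; ring)
  · exact affineSigns_of_eq h.abd h.abe h.ade h.bde (by unfold orient; ring)
  · exact affineSigns_of_eq h.acd h.ace h.ade h.cde (by unfold orient; ring)
  · exact affineSigns_of_eq h.bcd h.bce h.bde h.cde (by unfold orient; ring)

/-- A segment crosses the boundary of a triangle an odd number of times iff exactly one of its
ends is inside. -/
theorem FiveGeneric.crosses_triangle {a b c d e : Plane} (h : FiveGeneric a b c d e) :
    (crosses a b d e ^^ crosses b c d e ^^ crosses c a d e) =
      (insideTriangle a b c d ^^ insideTriangle a b c e) := by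
  have := triangle_signs_table _ _ _ _ _ _ _ _ _ _ h.fiveSigns
  unfold crosses insideTriangle
  rw [orientSign_rotate a d e, orientSign_rotate b d e, orientSign_rotate c d e,
    orientSign_swap h.acd, orientSign_swap h.ace]
  exact this

theorem crosses_of_order {a b c d : Plane} (habc : orient a b c ≠ 0) (habd : orient a b d ≠ 0)
    (hacd : orient a c d ≠ 0) (hbcd : orient b c d ≠ 0) :
    crosses a b c d = ((orientSign a b c ^^ orientSign a b d) &&
        (orientSign a c d ^^ orientSign b c d)) ∧
    crosses a c b d = ((!orientSign a b c ^^ orientSign a c d) &&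
        (orientSign a b d ^^ !orientSign b c d)) ∧
    crosses a d b c = ((!orientSign a b d ^^ !orientSign a c d) &&
        (orientSign a b c ^^ orientSign b c d)) := by
  unfold crosses
  refine ⟨?_, ?_, ?_⟩
  · rw [orientSign_rotate a c d, orientSign_rotate b c d]
  · rw [orientSign_rotate a b d, orientSign_swap_right habc, orientSign_swap_right hbcd]
  · rw [orientSign_rotate a b c, orientSign_swap_right habd, orientSign_swap_right hacd]

/-- The straight-line drawing of the complete graph on five points in general position has an
odd number of crossings. -/
theorem FiveGeneric.crosses_odd {a b c d e : Plane} (h : FiveGeneric a b c d e) :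
    ((crosses a b c d ^^ crosses a c b d ^^ crosses a d b c) ^^
      (crosses a b c e ^^ crosses a c b e ^^ crosses a e b c) ^^
      (crosses a b d e ^^ crosses a d b e ^^ crosses a e b d) ^^
      (crosses a c d e ^^ crosses a d c e ^^ crosses a e c d) ^^
      (crosses b c d e ^^ crosses b d c e ^^ crosses b e c d)) = true := by
  have := five_signs_table _ _ _ _ _ _ _ _ _ _ h.fiveSigns
  obtain ⟨h1, h2, h3⟩ := crosses_of_order h.abc h.abd h.acd h.bcd
  obtain ⟨h4, h5, h6⟩ := crosses_of_order h.abc h.abe h.ace h.bce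
  obtain ⟨h7, h8, h9⟩ := crosses_of_order h.abd h.abe h.ade h.bde
  obtain ⟨h10, h11, h12⟩ := crosses_of_order h.acd h.ace h.ade h.cde
  obtain ⟨h13, h14, h15⟩ := crosses_of_order h.bcd h.bce h.bde h.cde
  rw [h1, h2, h3, h4, h5, h6, h7, h8, h9, h10, h11, h12, h13, h14, h15]
  exact this

/-! ### Crossing numbers of polygonal paths modulo two -/

/-- A Boolean as an element of `ZMod 2`. -/
def parity (b : Bool) : ZMod 2 := if b then 1 else 0

theorem parity_xor : ∀ x y : Bool, parity (x ^^ y) = parity x + parity y := by decide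

section Paths

variable {ι : Type*}

/-- The points `q i` are in general position: no three of them are collinear. -/
def InGeneralPosition (q : ι → Plane) : Prop :=
  ∀ i j k, i ≠ j → i ≠ k → j ≠ k → orient (q i) (q j) (q k) ≠ 0

theorem InGeneralPosition.fiveGeneric {q : ι → Plane} (hq : InGeneralPosition q)
    {a b c d e : ι} (hab : a ≠ b) (hac : a ≠ c) (had : a ≠ d) (hae : a ≠ e) (hbc : b ≠ c)
    (hbd : b ≠ d) (hbe : b ≠ e) (hcd : c ≠ d) (hce : c ≠ e) (hde : d ≠ e) :
    FiveGeneric (q a) (q b) (q c) (q d) (q e) :=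
  ⟨hq _ _ _ hab hac hbc, hq _ _ _ hab had hbd, hq _ _ _ hab hae hbe, hq _ _ _ hac had hcd,
    hq _ _ _ hac hae hce, hq _ _ _ had hae hde, hq _ _ _ hbc hbd hcd, hq _ _ _ hbc hbe hce,
    hq _ _ _ hbd hbe hde, hq _ _ _ hcd hce hde⟩

/-- The crossing number modulo two of the segments `q a, q b` and `q c, q d`. -/
noncomputable def crossNum (q : ι → Plane) (a b c d : ι) : ZMod 2 :=
  parity (crosses (q a) (q b) (q c) (q d))

theorem crossNum_comm (q : ι → Plane) (a b c d : ι) :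
    crossNum q a b c d = crossNum q c d a b := by
  unfold crossNum
  rw [crosses_comm]

theorem crossNum_swap_left {q : ι → Plane} (hq : InGeneralPosition q) {a b c d : ι}
    (hab : a ≠ b) (hac : a ≠ c) (had : a ≠ d) (hbc : b ≠ c) (hbd : b ≠ d) :
    crossNum q a b c d = crossNum q b a c d := by
  unfold crossNum crosses
  rw [orientSign_swap (hq _ _ _ hab hac hbc), orientSign_swap (hq _ _ _ hab had hbd)]
  congr 1
  cases orientSign (q a) (q b) (q c) <;> cases orientSign (q a) (q b) (q d) <;>
    cases orientSign (q c) (q d) (q a) <;> cases orientSign (q c) (q d) (q b) <;> rfl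

theorem crossNum_triangle {q : ι → Plane} (hq : InGeneralPosition q)
    {a b c d e : ι} (hab : a ≠ b) (hac : a ≠ c) (had : a ≠ d) (hae : a ≠ e) (hbc : b ≠ c)
    (hbd : b ≠ d) (hbe : b ≠ e) (hcd : c ≠ d) (hce : c ≠ e) (hde : d ≠ e) :
    crossNum q a b d e + crossNum q b c d e + crossNum q c a d e =
      parity (insideTriangle (q a) (q b) (q c) (q d)) +
        parity (insideTriangle (q a) (q b) (q c) (q e)) := by
  unfold crossNum
  rw [← parity_xor, ← parity_xor, ← parity_xor,
    (hq.fiveGeneric hab hac had hae hbc hbd hbe hcd hce hde).crosses_triangle]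

/-- A path with `len` steps that visits `vert 0, …, vert len`. -/
structure IndexPath (ι : Type*) where
  vert : ℕ → ι
  len : ℕ

/-- `P` is a simple path from `a` to `b` inside the set `T`. -/
structure IndexPath.IsPathIn (P : IndexPath ι) (a b : ι) (T : Set ι) : Prop where
  start : P.vert 0 = a
  finish : P.vert P.len = b
  len_pos : 0 < P.len
  inj : Set.InjOn P.vert (Set.Iic P.len)
  mem : ∀ k ≤ P.len, P.vert k ∈ T

/-- The number modulo two of crossings between two paths. -/
noncomputable def pathCrossNum (q : ι → Plane) (P R : IndexPath ι) : ZMod 2 :=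
  ∑ k ∈ Finset.range P.len, ∑ l ∈ Finset.range R.len,
    crossNum q (P.vert k) (P.vert (k + 1)) (R.vert l) (R.vert (l + 1))

theorem pathCrossNum_comm (q : ι → Plane) (P R : IndexPath ι) :
    pathCrossNum q P R = pathCrossNum q R P := by
  unfold pathCrossNum
  rw [Finset.sum_comm]
  exact Finset.sum_congr rfl fun _ _ => Finset.sum_congr rfl fun _ _ => crossNum_comm ..

/-- Each step of `R` crosses the triangle with the parity by which its ends differ in being inside;
along the path these contributions telescope modulo two. -/
theorem sum_crossNum_triangle {q : ι → Plane} (hq : InGeneralPosition q) {a b c d e : ι}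
    {T : Set ι} {R : IndexPath ι} (hR : R.IsPathIn d e T)
    (hab : a ≠ b) (hac : a ≠ c) (hbc : b ≠ c) (ha : a ∉ T) (hb : b ∉ T) (hc : c ∉ T) :
    (∑ l ∈ Finset.range R.len, crossNum q a b (R.vert l) (R.vert (l + 1))) +
      (∑ l ∈ Finset.range R.len, crossNum q b c (R.vert l) (R.vert (l + 1))) +
      (∑ l ∈ Finset.range R.len, crossNum q c a (R.vert l) (R.vert (l + 1))) =
      parity (insideTriangle (q a) (q b) (q c) (q d)) +
        parity (insideTriangle (q a) (q b) (q c) (q e)) := by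
  have two : ∀ x : ZMod 2, x + x = 0 := by decide
  have key : ∀ m ≤ R.len, (∑ l ∈ Finset.range m, (crossNum q a b (R.vert l) (R.vert (l + 1)) +
      crossNum q b c (R.vert l) (R.vert (l + 1)) +
      crossNum q c a (R.vert l) (R.vert (l + 1)))) =
      parity (insideTriangle (q a) (q b) (q c) (q (R.vert 0))) +
        parity (insideTriangle (q a) (q b) (q c) (q (R.vert m))) := by
    intro m
    induction m with
    | zero => intro _; simp [two]
    | succ m ih =>
      intro hm
      have h1 := hR.mem m (by omega)
      have h2 := hR.mem (m + 1) hm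
      rw [Finset.sum_range_succ, ih (by omega), crossNum_triangle hq hab hac
        (fun h => ha (h ▸ h1)) (fun h => ha (h ▸ h2)) hbc (fun h => hb (h ▸ h1))
        (fun h => hb (h ▸ h2)) (fun h => hc (h ▸ h1)) (fun h => hc (h ▸ h2))]
      · linear_combination two (parity (insideTriangle (q a) (q b) (q c) (q (R.vert m))))
      · intro h
        have := hR.inj (x₁ := m) (x₂ := m + 1) (by simp; omega) (by simpa using hm) h
        omega
  rw [← Finset.sum_add_distrib, ← Finset.sum_add_distrib, key _ le_rfl, hR.start, hR.finish]

/-- Modulo two, the number of crossings between a path and a closed curve made of three paths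
depends only on the ends of the path. -/
theorem pathCrossNum_replace {q : ι → Plane} (hq : InGeneralPosition q) {a b x y z : ι}
    {S T : Set ι} (hST : Disjoint S T) {P P' R₁ R₂ R₃ : IndexPath ι}
    (hP : P.IsPathIn a b S) (hP' : P'.IsPathIn a b S)
    (h₁ : R₁.IsPathIn x y T) (h₂ : R₂.IsPathIn x z T) (h₃ : R₃.IsPathIn y z T) :
    pathCrossNum q P R₁ + pathCrossNum q P R₂ + pathCrossNum q P R₃ =
      pathCrossNum q P' R₁ + pathCrossNum q P' R₂ + pathCrossNum q P' R₃ := by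
  have two : ∀ x : ZMod 2, x + x = 0 := by decide
  have hS : ∀ s ∈ S, s ∉ T := fun s hs ht => Set.disjoint_left.1 hST hs ht
  -- The parity of crossings of the segment `c d` with the closed curve formed by `R₁`, `R₂`, `R₃`.
  let Φ : ι → ι → ZMod 2 := fun c d =>
    (∑ l ∈ Finset.range R₁.len, crossNum q c d (R₁.vert l) (R₁.vert (l + 1))) +
    (∑ l ∈ Finset.range R₂.len, crossNum q c d (R₂.vert l) (R₂.vert (l + 1))) +
    (∑ l ∈ Finset.range R₃.len, crossNum q c d (R₃.vert l) (R₃.vert (l + 1)))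
  -- A triangle meets the closed curve evenly, because each of `x`, `y`, `z` is an end of exactly
  -- two of the three paths.
  have tri : ∀ c d e, c ∈ S → d ∈ S → e ∈ S → c ≠ d → c ≠ e → d ≠ e →
      Φ c d + Φ d e + Φ e c = 0 := by
    intro c d e hc hd he hcd hce hde
    have e1 := sum_crossNum_triangle hq h₁ hcd hce hde (hS _ hc) (hS _ hd) (hS _ he)
    have e2 := sum_crossNum_triangle hq h₂ hcd hce hde (hS _ hc) (hS _ hd) (hS _ he)
    have e3 := sum_crossNum_triangle hq h₃ hcd hce hde (hS _ hc) (hS _ hd) (hS _ he)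
    linear_combination e1 + e2 + e3 + two (parity (insideTriangle (q c) (q d) (q e) (q x))) +
      two (parity (insideTriangle (q c) (q d) (q e) (q y))) +
      two (parity (insideTriangle (q c) (q d) (q e) (q z)))
  have symm : ∀ c d, c ∈ S → d ∈ S → c ≠ d → Φ c d = Φ d c := by
    intro c d hc hd hcd
    have aux : ∀ {u v} {R : IndexPath ι}, R.IsPathIn u v T →
        (∑ l ∈ Finset.range R.len, crossNum q c d (R.vert l) (R.vert (l + 1))) =
        ∑ l ∈ Finset.range R.len, crossNum q d c (R.vert l) (R.vert (l + 1)) := by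
      intro u v R hR
      refine Finset.sum_congr rfl fun l hl => ?_
      rw [Finset.mem_range] at hl
      have m1 := hR.mem l (by omega)
      have m2 := hR.mem (l + 1) (by omega)
      exact crossNum_swap_left hq hcd (fun h => hS _ hc (h ▸ m1)) (fun h => hS _ hc (h ▸ m2))
        (fun h => hS _ hd (h ▸ m1)) (fun h => hS _ hd (h ▸ m2))
    exact congrArg₂ (· + ·) (congrArg₂ (· + ·) (aux h₁) (aux h₂)) (aux h₃)
  have main : ∀ {W : IndexPath ι}, W.IsPathIn a b S →
      pathCrossNum q W R₁ + pathCrossNum q W R₂ + pathCrossNum q W R₃ = Φ a b := by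
    intro W hW
    -- Fan triangulation from the first corner: by `tri`, two consecutive sides can be replaced by
    -- the third.
    have key : ∀ m, m + 1 ≤ W.len →
        ∑ k ∈ Finset.range (m + 1), Φ (W.vert k) (W.vert (k + 1)) =
          Φ (W.vert 0) (W.vert (m + 1)) := by
      intro m
      induction m with
      | zero => intro _; simp
      | succ m ih =>
        intro hm
        have ne : ∀ i j, i < j → j ≤ W.len → W.vert i ≠ W.vert j := by
          intro i j hij hj h
          have := hW.inj (x₁ := i) (x₂ := j) (by simp; omega) (by simpa using hj) h
          omega
        rw [Finset.sum_range_succ, ih (by omega)]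
        have t := tri _ _ _ (hW.mem 0 (by omega)) (hW.mem (m + 1) (by omega))
          (hW.mem (m + 2) hm) (ne _ _ (by omega) (by omega)) (ne _ _ (by omega) (by omega))
          (ne _ _ (by omega) (by omega))
        have s := symm _ _ (hW.mem 0 (by omega)) (hW.mem (m + 2) hm)
          (ne _ _ (by omega) (by omega))
        rw [← s] at t
        linear_combination t - two (Φ (W.vert 0) (W.vert (m + 2)))
    obtain ⟨m, hm⟩ : ∃ m, W.len = m + 1 := ⟨W.len - 1, by have := hW.len_pos; omega⟩
    have k := key m hm.ge
    rw [← hm, hW.start, hW.finish] at k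
    rw [← k]
    unfold pathCrossNum
    rw [← Finset.sum_add_distrib, ← Finset.sum_add_distrib]
  rw [main hP, main hP']

/-- The path with a single step. -/
def IndexPath.single (a b : ι) : IndexPath ι where
  vert k := if k = 0 then a else b
  len := 1

theorem IndexPath.isPathIn_single {a b : ι} (hab : a ≠ b) {T : Set ι}
    (ha : a ∈ T) (hb : b ∈ T) : (IndexPath.single a b).IsPathIn a b T where
  start := rfl
  finish := rfl
  len_pos := Nat.one_pos
  inj := by
    intro i hi j hj h
    simp only [IndexPath.single, Set.mem_Iic] at hi hj h
    split_ifs at h with h1 h2 h2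
    · omega
    · exact absurd h hab
    · exact absurd h.symm hab
    · omega
  mem k _ := by
    simp only [IndexPath.single]
    split_ifs <;> assumption

theorem pathCrossNum_single (q : ι → Plane) (a b c d : ι) :
    pathCrossNum q (.single a b) (.single c d) = crossNum q a b c d := by
  simp [pathCrossNum, IndexPath.single]

end Paths

/-- In a drawing of the complete graph on five vertices by polygonal paths with corners in general
position, where the path from `i` to `j` uses its own corners `(i, j, k)`, the number of crossings
between paths without a common end is odd. -/
theorem sum_pathCrossNum_completeGraph {q : Fin 5 ⊕ (Fin 5 × Fin 5 × ℕ) → Plane}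
    (hq : InGeneralPosition q) (P : Fin 5 → Fin 5 → IndexPath (Fin 5 ⊕ (Fin 5 × Fin 5 × ℕ)))
    (hP : ∀ i j, i ≠ j → (P i j).IsPathIn (.inl i) (.inl j)
      ({.inl i, .inl j} ∪ Set.range fun k => .inr (i, j, k))) :
    ∃ i j k l, i ≠ j ∧ i ≠ k ∧ i ≠ l ∧ j ≠ k ∧ j ≠ l ∧ k ≠ l ∧
      pathCrossNum q (P i j) (P k l) ≠ 0 := by
  by_contra! hcon
  let own : Fin 5 → Fin 5 → Set (Fin 5 ⊕ (Fin 5 × Fin 5 × ℕ)) := fun i j =>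
    {.inl i, .inl j} ∪ Set.range fun k => .inr (i, j, k)
  let A : Fin 5 → Fin 5 → IndexPath (Fin 5 ⊕ (Fin 5 × Fin 5 × ℕ)) :=
    fun i j => .single (.inl i) (.inl j)
  have hA : ∀ i j, i ≠ j → (A i j).IsPathIn (.inl i) (.inl j) (own i j) := fun i j hij =>
    IndexPath.isPathIn_single (by simpa using hij) (by simp [own]) (by simp [own])
  have mono : ∀ {R : IndexPath (Fin 5 ⊕ (Fin 5 × Fin 5 × ℕ))} {a b S T}, R.IsPathIn a b S →
      S ⊆ T → R.IsPathIn a b T := fun h hST =>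
    ⟨h.start, h.finish, h.len_pos, h.inj, fun k hk => hST (h.mem k hk)⟩
  have rep : ∀ i j x y z : Fin 5, i ≠ j → [i, j, x, y, z].Nodup →
      ∀ R₁ R₂ R₃, R₁.IsPathIn (.inl x) (.inl y) (own x y) →
      R₂.IsPathIn (.inl x) (.inl z) (own x z) → R₃.IsPathIn (.inl y) (.inl z) (own y z) →
      pathCrossNum q (P i j) R₁ + pathCrossNum q (P i j) R₂ + pathCrossNum q (P i j) R₃ =
      pathCrossNum q (A i j) R₁ + pathCrossNum q (A i j) R₂ + pathCrossNum q (A i j) R₃ := by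
    intro i j x y z hij hnd R₁ R₂ R₃ h₁ h₂ h₃
    refine pathCrossNum_replace hq (S := own i j) (T := own x y ∪ own x z ∪ own y z) ?_
      (hP i j hij) (hA i j hij)
      (mono h₁ fun _ h => .inl (.inl h)) (mono h₂ fun _ h => .inl (.inr h))
      (mono h₃ fun _ h => .inr h)
    simp only [List.nodup_cons, List.mem_cons, not_or, List.not_mem_nil] at hnd
    rw [Set.disjoint_left]
    rintro (v | ⟨v, w, k⟩) h1 h2
    · simp [own] at h1 h2
      grind
    · simp [own] at h1 h2
      grind
  have nd : ∀ i j : Fin 5, i ≠ j → (P i j).IsPathIn (.inl i) (.inl j) (own i j) := hP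
  -- The ten edges are straightened in lexicographic order. For each one, the opposite triangle is
  -- formed by straight segments for edges already treated and by the original paths for the others.
  have h01 := rep 0 1 2 3 4 (by decide) (by decide) _ _ _ (nd 2 3 (by decide))
    (nd 2 4 (by decide)) (nd 3 4 (by decide))
  have h02 := rep 0 2 1 3 4 (by decide) (by decide) _ _ _ (nd 1 3 (by decide))
    (nd 1 4 (by decide)) (nd 3 4 (by decide))
  have h03 := rep 0 3 1 2 4 (by decide) (by decide) _ _ _ (nd 1 2 (by decide))
    (nd 1 4 (by decide)) (nd 2 4 (by decide))
  have h04 := rep 0 4 1 2 3 (by decide) (by decide) _ _ _ (nd 1 2 (by decide))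
    (nd 1 3 (by decide)) (nd 2 3 (by decide))
  have h12 := rep 1 2 0 3 4 (by decide) (by decide) _ _ _ (hA 0 3 (by decide))
    (hA 0 4 (by decide)) (nd 3 4 (by decide))
  have h13 := rep 1 3 0 2 4 (by decide) (by decide) _ _ _ (hA 0 2 (by decide))
    (hA 0 4 (by decide)) (nd 2 4 (by decide))
  have h14 := rep 1 4 0 2 3 (by decide) (by decide) _ _ _ (hA 0 2 (by decide))
    (hA 0 3 (by decide)) (nd 2 3 (by decide))
  have h23 := rep 2 3 0 1 4 (by decide) (by decide) _ _ _ (hA 0 1 (by decide))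
    (hA 0 4 (by decide)) (hA 1 4 (by decide))
  have h24 := rep 2 4 0 1 3 (by decide) (by decide) _ _ _ (hA 0 1 (by decide))
    (hA 0 3 (by decide)) (hA 1 3 (by decide))
  have h34 := rep 3 4 0 1 2 (by decide) (by decide) _ _ _ (hA 0 1 (by decide))
    (hA 0 2 (by decide)) (hA 1 2 (by decide))
  have odd := (hq.fiveGeneric (a := .inl 0) (b := .inl 1) (c := .inl 2) (d := .inl 3)
    (e := .inl 4) (by simp) (by simp) (by simp) (by simp) (by simp) (by simp) (by simp)
    (by simp) (by simp) (by simp)).crosses_odd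
  replace odd := congrArg parity odd
  simp only [parity_xor] at odd
  have sA : ∀ i j k l : Fin 5, pathCrossNum q (A i j) (A k l) =
      parity (crosses (q (.inl i)) (q (.inl j)) (q (.inl k)) (q (.inl l))) := fun i j k l =>
    pathCrossNum_single q _ _ _ _
  simp only [← sA] at odd
  have one : parity true = 1 := rfl
  rw [one] at odd
  have z : ∀ i j k l : Fin 5, [i, j, k, l].Nodup → pathCrossNum q (P i j) (P k l) = 0 := by
    intro i j k l h
    simp only [List.nodup_cons, List.mem_cons, not_or, List.not_mem_nil] at h
    exact hcon i j k l h.1.1 h.1.2.1 h.1.2.2.1 h.2.1.1 h.2.1.2.1 h.2.2.1.1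
  have cm := pathCrossNum_comm q
  rw [cm (P 1 2) (A 0 3), cm (P 1 2) (A 0 4), cm (A 1 2) (A 0 3), cm (A 1 2) (A 0 4)] at h12
  rw [cm (P 1 3) (A 0 2), cm (P 1 3) (A 0 4), cm (A 1 3) (A 0 2), cm (A 1 3) (A 0 4)] at h13
  rw [cm (P 1 4) (A 0 2), cm (P 1 4) (A 0 3), cm (A 1 4) (A 0 2), cm (A 1 4) (A 0 3)] at h14
  rw [cm (P 2 3) (A 0 1), cm (P 2 3) (A 0 4), cm (P 2 3) (A 1 4), cm (A 2 3) (A 0 1),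
    cm (A 2 3) (A 0 4), cm (A 2 3) (A 1 4)] at h23
  rw [cm (P 2 4) (A 0 1), cm (P 2 4) (A 0 3), cm (P 2 4) (A 1 3), cm (A 2 4) (A 0 1),
    cm (A 2 4) (A 0 3), cm (A 2 4) (A 1 3)] at h24
  rw [cm (P 3 4) (A 0 1), cm (P 3 4) (A 0 2), cm (P 3 4) (A 1 2), cm (A 3 4) (A 0 1),
    cm (A 3 4) (A 0 2), cm (A 3 4) (A 1 2)] at h34
  refine one_ne_zero (α := ZMod 2) ?_
  rw [z 0 1 2 3 (by decide), z 0 1 2 4 (by decide), z 0 1 3 4 (by decide)] at h01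
  rw [z 0 2 1 3 (by decide), z 0 2 1 4 (by decide), z 0 2 3 4 (by decide)] at h02
  rw [z 0 3 1 2 (by decide), z 0 3 1 4 (by decide), z 0 3 2 4 (by decide)] at h03
  rw [z 0 4 1 2 (by decide), z 0 4 1 3 (by decide), z 0 4 2 3 (by decide)] at h04
  -- The ten relations telescope from the straight drawing to the original one. The crossings of
  -- edges at `0` have already been set to zero; the three remaining pairs lie inside `{1, 2, 3,
  -- 4}`.
  linear_combination - odd - h01 - h02 - h03 - h04 - h12 - h13 - h14 - h23 - h24 - h34 +
    z 1 2 3 4 (by decide) + z 1 3 2 4 (by decide) + z 1 4 2 3 (by decide)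

/-! ### General position by perturbation -/

/-- The perturbation of the points `q i` in the direction of distinct points of a parabola. -/
def perturb {ι : Type*} (q : ι → Plane) (m : ι → ℝ) (s : ℝ) (i : ι) : Plane :=
  q i + s • (m i, m i ^ 2)

theorem countable_quadratic_roots {α : ℝ} (hα : α ≠ 0) (β γ : ℝ) :
    {s : ℝ | α * s ^ 2 + β * s + γ = 0}.Countable := by
  open Polynomial in
  let f : ℝ[X] := C α * X ^ 2 + C β * X + C γ
  have hf : f ≠ 0 := by
    intro h
    have h2 : f.natDegree = 2 := Polynomial.natDegree_quadratic hα
    rw [h, Polynomial.natDegree_zero] at h2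
    omega
  refine (f.roots.toFinset.finite_toSet.subset ?_).countable
  intro s hs
  simpa [hf, f] using hs

/-- The orientation is a quadratic polynomial in `s` whose leading coefficient is the Vandermonde
product of the three parameters, that is, the orientation of three distinct points of the parabola.
-/
theorem countable_orient_perturb_eq_zero {ι : Type*} (q : ι → Plane) {m : ι → ℝ}
    (hm : Function.Injective m) {i j k : ι} (hij : i ≠ j) (hik : i ≠ k) (hjk : j ≠ k) :
    {s : ℝ | orient (perturb q m s i) (perturb q m s j) (perturb q m s k) = 0}.Countable := by
  have hα : (m j - m i) * (m k - m i) * (m k - m j) ≠ 0 :=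
    mul_ne_zero (mul_ne_zero (sub_ne_zero.2 fun h => hij (hm h).symm)
      (sub_ne_zero.2 fun h => hik (hm h).symm)) (sub_ne_zero.2 fun h => hjk (hm h).symm)
  refine (countable_quadratic_roots hα
    (((q j).1 - (q i).1) * (m k ^ 2 - m i ^ 2) + (m j - m i) * ((q k).2 - (q i).2) -
      ((q j).2 - (q i).2) * (m k - m i) - (m j ^ 2 - m i ^ 2) * ((q k).1 - (q i).1))
    (orient (q i) (q j) (q k))).mono ?_
  intro s (hs : _ = _)
  change _ = _
  rw [← hs]
  simp only [orient, perturb, Prod.fst_add, Prod.snd_add, Prod.smul_mk, smul_eq_mul]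
  ring

/-- Only countably many `s` are bad, and a countable set has dense complement in `ℝ`. -/
theorem exists_perturb_inGeneralPosition {ι : Type*} [Countable ι] (q : ι → Plane) {m : ι → ℝ}
    (hm : Function.Injective m) {p : ℝ → Prop} (hp : ∀ᶠ s in nhds 0, p s) :
    ∃ s, p s ∧ InGeneralPosition (perturb q m s) := by
  have hc : (⋃ (t : {t : ι × ι × ι // t.1 ≠ t.2.1 ∧ t.1 ≠ t.2.2 ∧ t.2.1 ≠ t.2.2}),
      {s : ℝ | orient (perturb q m s t.1.1) (perturb q m s t.1.2.1)
        (perturb q m s t.1.2.2) = 0}).Countable :=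
    Set.countable_iUnion fun t =>
      countable_orient_perturb_eq_zero q hm t.2.1 t.2.2.1 t.2.2.2
  obtain ⟨U, hU, hUo, h0⟩ := eventually_nhds_iff.1 hp
  obtain ⟨s, hs, hsU⟩ := (hc.dense_compl ℝ).inter_open_nonempty U hUo ⟨0, h0⟩
  refine ⟨s, hU s hs, fun i j k hij hik hjk h => hsU ?_⟩
  exact Set.mem_iUnion.2 ⟨⟨(i, j, k), hij, hik, hjk⟩, h⟩

/-- Coincidences of points of the two segments form a closed set in parameter space, and projection
along the compact square of segment parameters is a closed map. -/
theorem eventually_disjoint_segment {a b c d : ℝ → Plane} (ha : Continuous a)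
    (hb : Continuous b) (hc : Continuous c) (hd : Continuous d)
    (h : Disjoint (segment ℝ (a 0) (b 0)) (segment ℝ (c 0) (d 0))) :
    ∀ᶠ s in nhds 0, Disjoint (segment ℝ (a s) (b s)) (segment ℝ (c s) (d s)) := by
  let I := Set.Icc (0 : ℝ) 1
  let K : Set ((I × I) × ℝ) := {x | a x.2 + (x.1.1 : ℝ) • (b x.2 - a x.2) =
    c x.2 + (x.1.2 : ℝ) • (d x.2 - c x.2)}
  have hK : IsClosed K := isClosed_eq (by fun_prop) (by fun_prop)
  have hK' : IsClosed (Prod.snd '' K) := isClosedMap_snd_of_compactSpace _ hK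
  have key : ∀ s, s ∉ Prod.snd '' K →
      Disjoint (segment ℝ (a s) (b s)) (segment ℝ (c s) (d s)) := by
    intro s hs
    rw [Set.disjoint_left]
    intro z h1 h2
    rw [segment_eq_image'] at h1 h2
    obtain ⟨u, hu, rfl⟩ := h1
    obtain ⟨v, hv, hz⟩ := h2
    exact hs ⟨((⟨u, hu⟩, ⟨v, hv⟩), s), hz.symm, rfl⟩
  have h0 : (0 : ℝ) ∉ Prod.snd '' K := by
    rintro ⟨⟨⟨u, v⟩, s⟩, hk, rfl⟩
    refine Set.disjoint_left.1 h (?_ : a 0 + (u : ℝ) • (b 0 - a 0) ∈ _) ?_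
    · rw [segment_eq_image']; exact ⟨u, u.2, rfl⟩
    · rw [segment_eq_image']; exact ⟨v, v.2, hk.symm⟩
  filter_upwards [hK'.isOpen_compl.mem_nhds h0] with s hs using key s hs

/-! ### Weakly planar graphs -/

/-- The points `a` and `b` are joined by a polygonal curve in `Z`. -/
def PolyJoined (Z : Set Plane) (a b : Plane) : Prop :=
  a ∈ Z ∧ Relation.ReflTransGen (fun x y => segment ℝ x y ⊆ Z) a b

theorem PolyJoined.mono {Z W : Set Plane} {a b : Plane} (h : PolyJoined Z a b) (hZ : Z ⊆ W) :
    PolyJoined W a b :=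
  ⟨hZ h.1, Relation.ReflTransGen.mono (fun _ _ h => h.trans hZ) _ _ h.2⟩

theorem PolyJoined.trans {Z : Set Plane} {a b c : Plane} (h : PolyJoined Z a b)
    (h' : PolyJoined Z b c) : PolyJoined Z a c :=
  ⟨h.1, h.2.trans h'.2⟩

theorem PolyJoined.exists_corners {Z : Set Plane} {a b : Plane} (h : PolyJoined Z a b) :
    ∃ (n : ℕ) (w : ℕ → Plane), w 0 = a ∧ w n = b ∧ (∀ k < n, segment ℝ (w k) (w (k + 1)) ⊆ Z) ∧
      b ∈ Z := by
  obtain ⟨ha, h⟩ := h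
  induction h with
  | refl => exact ⟨0, fun _ => a, rfl, rfl, by simp, ha⟩
  | @tail b c _ hbc ih =>
    obtain ⟨n, w, h0, hn, hw, -⟩ := ih
    refine ⟨n + 1, fun k => if k ≤ n then w k else c, by simp [h0], by simp, ?_,
      hbc (right_mem_segment ℝ _ _)⟩
    intro k hk
    rcases Nat.lt_succ_iff_lt_or_eq.1 hk with hk | rfl
    · simpa [hk.le, Nat.succ_le_of_lt hk] using hw k hk
    · simpa [hn] using hbc

/-- A graph is weakly planar if it has a drawing in which edges without a common end are
disjoint. -/
def WeaklyPlanar {V : Type*} (G : SimpleGraph V) : Prop :=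
  ∃ (p : V → Plane) (Z : V → V → Set Plane),
    (∀ a b, G.Adj a b → PolyJoined (Z a b) (p a) (p b)) ∧
    ∀ a b c d, G.Adj a b → G.Adj c d → a ≠ c → a ≠ d → b ≠ c → b ≠ d →
      Disjoint (Z a b) (Z c d)

theorem WeaklyPlanar.mono {V : Type*} {G H : SimpleGraph V} (hG : WeaklyPlanar G) (h : H ≤ G) :
    WeaklyPlanar H := by
  obtain ⟨p, Z, h1, h2⟩ := hG
  exact ⟨p, Z, fun a b hab => h1 a b (h hab),
    fun a b c d hab hcd => h2 a b c d (h hab) (h hcd)⟩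

theorem IsPlanar.weaklyPlanar {V : Type} {G : SimpleGraph V} (hG : IsPlanar G) :
    WeaklyPlanar G := by
  obtain ⟨E⟩ := hG
  refine ⟨E.point, fun a b => E.arc s(a, b), fun a b hab => ?_, ?_⟩
  · obtain ⟨n, q, h0, hn, hA, -⟩ := E.isPolygonalArc a b hab
    have hsub : ∀ i ≤ n, segment ℝ (q i) (q (i + 1)) ⊆ E.arc s(a, b) := by
      intro i hi
      rw [hA]
      exact Set.subset_biUnion_of_mem (u := fun i => segment ℝ (q i) (q (i + 1)))
        (Set.mem_Iic.2 hi)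
    refine ⟨?_, ?_⟩
    · rw [← h0]
      exact hsub 0 (Nat.zero_le _) (left_mem_segment ℝ _ _)
    · have : ∀ k ≤ n + 1, Relation.ReflTransGen
          (fun x y => segment ℝ x y ⊆ E.arc s(a, b)) (q 0) (q k) := by
        intro k
        induction k with
        | zero => intro _; exact .refl
        | succ k ih => intro hk; exact (ih (by omega)).tail (hsub k (by omega))
      rw [← h0, ← hn]
      exact this _ le_rfl
  · intro a b c d hab hcd hac had hbc hbd
    rw [Set.disjoint_left]
    intro z hz hz'
    have hne : s(a, b) ≠ s(c, d) := by
      rw [Ne, Sym2.eq_iff]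
      tauto
    by_cases h1 : z ∈ E.point '' {w | w ∈ s(a, b)}
    · by_cases h2 : z ∈ E.point '' {w | w ∈ s(c, d)}
      · obtain ⟨w, hw, rfl⟩ := h1
        obtain ⟨w', hw', h⟩ := h2
        obtain rfl := E.point_injective h
        simp only [Set.mem_ofPred_eq, Sym2.mem_iff] at hw hw'
        grind
      · obtain ⟨w, hw, rfl⟩ := h1
        exact Set.disjoint_left.1 (E.interior_disjoint_vertices _ hcd) ⟨hz', h2⟩ ⟨w, rfl⟩
    · exact Set.disjoint_left.1 (E.interior_disjoint_edges _ hab _ hcd hne) ⟨hz, h1⟩ hz'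

/-- Five points cannot be joined pairwise so that curves without a common end are disjoint. -/
theorem not_weaklyPlanar_top_five : ¬ WeaklyPlanar (⊤ : SimpleGraph (Fin 5)) := by
  rintro ⟨p, Z, hZ, hdis⟩
  have hex : ∀ i j : Fin 5, ∃ (n : ℕ) (w : ℕ → Plane), i ≠ j → w 0 = p i ∧ w n = p j ∧
      (∀ k < n, segment ℝ (w k) (w (k + 1)) ⊆ Z i j) ∧ p i ∈ Z i j ∧ p j ∈ Z i j := by
    intro i j
    by_cases hij : i = j
    · exact ⟨0, fun _ => p i, fun h => absurd hij h⟩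
    · obtain ⟨n, w, h0, hn, hw, hj⟩ := (hZ i j hij).exists_corners
      exact ⟨n, w, fun _ => ⟨h0, hn, hw, (hZ i j hij).1, hj⟩⟩
  choose n w hw using hex
  let q : Fin 5 ⊕ (Fin 5 × Fin 5 × ℕ) → Plane := Sum.elim p fun x => w x.1 x.2.1 x.2.2
  -- Between its ends the path visits its own corners `(i, j, 0), …, (i, j, n i j)`. The first and
  -- the last of them lie at `p i` and `p j`, so the two end segments are degenerate until the
  -- perturbation.
  let P : Fin 5 → Fin 5 → IndexPath (Fin 5 ⊕ (Fin 5 × Fin 5 × ℕ)) := fun i j =>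
    { vert := fun k => if k = 0 then .inl i else if k ≤ n i j + 1 then .inr (i, j, k - 1)
        else .inl j
      len := n i j + 2 }
  have hP : ∀ i j, i ≠ j → (P i j).IsPathIn (.inl i) (.inl j)
      ({.inl i, .inl j} ∪ Set.range fun k => .inr (i, j, k)) := by
    intro i j hij
    refine ⟨by simp [P], by simp [P], by simp [P], ?_, ?_⟩
    · intro k hk l hl h
      simp only [P, Set.mem_Iic] at hk hl h
      split_ifs at h <;> simp_all <;> omega
    · intro k hk
      simp only [P]
      split_ifs <;> simp
  have hseg : ∀ i j, i ≠ j → ∀ k < (P i j).len,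
      segment ℝ (q ((P i j).vert k)) (q ((P i j).vert (k + 1))) ⊆ Z i j := by
    intro i j hij k hk
    obtain ⟨h0, hn, hs, hi, hj⟩ := hw i j hij
    simp only [P] at hk
    rcases Nat.eq_zero_or_pos k with rfl | hk0
    · simpa [P, q, h0] using hi
    · rcases Nat.lt_or_ge k (n i j + 1) with hk1 | hk1
      · have := hs (k - 1) (by omega)
        rw [Nat.sub_add_cancel hk0] at this
        simpa [P, q, hk0.ne', hk1.le, Nat.lt_succ_iff.1 hk1] using this
      · obtain rfl : k = n i j + 1 := by omega
        simpa [P, q, hn] using hj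
  let m : Fin 5 ⊕ (Fin 5 × Fin 5 × ℕ) → ℝ := fun x => (Encodable.encode x : ℝ)
  have hm : Function.Injective m := fun x y h => Encodable.encode_injective (Nat.cast_injective h)
  have hcont : ∀ x, Continuous fun s => perturb q m s x := by
    intro x
    unfold perturb
    fun_prop
  have hzero : ∀ x, perturb q m 0 x = q x := by simp [perturb]
  have hev : ∀ᶠ s in nhds 0, ∀ i j k l : Fin 5, i ≠ j → i ≠ k → i ≠ l → j ≠ k → j ≠ l →
      k ≠ l → ∀ u ∈ Finset.range (P i j).len, ∀ v ∈ Finset.range (P k l).len,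
      Disjoint
        (segment ℝ (perturb q m s ((P i j).vert u)) (perturb q m s ((P i j).vert (u + 1))))
        (segment ℝ (perturb q m s ((P k l).vert v)) (perturb q m s ((P k l).vert (v + 1)))) := by
    simp only [Filter.eventually_all, Filter.eventually_all_finset]
    intro i j k l hij hik hil hjk hjl hkl u hu v hv
    rw [Finset.mem_range] at hu hv
    refine eventually_disjoint_segment (hcont _) (hcont _) (hcont _) (hcont _) ?_
    simp only [hzero]
    exact (hdis i j k l hij hkl hik hil hjk hjl).mono (hseg i j hij u hu) (hseg k l hkl v hv)
  obtain ⟨s, hs, hgen⟩ := exists_perturb_inGeneralPosition q hm hev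
  obtain ⟨i, j, k, l, hij, hik, hil, hjk, hjl, hkl, hne⟩ :=
    sum_pathCrossNum_completeGraph hgen P hP
  refine hne (Finset.sum_eq_zero fun u hu => Finset.sum_eq_zero fun v hv => ?_)
  have hd := hs i j k l hij hik hil hjk hjl hkl u hu v hv
  rw [Finset.mem_range] at hu hv
  unfold crossNum
  by_contra hcr
  have hcr' : crosses (perturb q m s ((P i j).vert u)) (perturb q m s ((P i j).vert (u + 1)))
      (perturb q m s ((P k l).vert v)) (perturb q m s ((P k l).vert (v + 1))) = true := by
    by_contra h
    exact hcr (by simp [parity, h])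
  have hsep : ∀ x ∈ ({.inl i, .inl j} ∪ Set.range fun k => .inr (i, j, k) :
      Set (Fin 5 ⊕ (Fin 5 × Fin 5 × ℕ))), ∀ y ∈ ({.inl k, .inl l} ∪
      Set.range fun t => .inr (k, l, t) : Set (Fin 5 ⊕ (Fin 5 × Fin 5 × ℕ))), x ≠ y := by
    rintro x hx y hy rfl
    rcases x with x | ⟨x, x', t⟩
    · simp at hx hy
      grind
    · simp at hx hy
      grind
  have hinj : ∀ i j, i ≠ j → ∀ u < (P i j).len, (P i j).vert u ≠ (P i j).vert (u + 1) := by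
    intro i j hij u hu h
    have := (hP i j hij).inj (x₁ := u) (x₂ := u + 1) hu.le (Nat.succ_le_of_lt hu) h
    omega
  have a1 := (hP i j hij).mem u hu.le
  have a2 := (hP i j hij).mem (u + 1) hu
  have b1 := (hP k l hkl).mem v hv.le
  have b2 := (hP k l hkl).mem (v + 1) hv
  obtain ⟨z, hz1, hz2⟩ := segment_inter_of_crosses hcr'
    (hgen _ _ _ (hinj i j hij u hu) (hsep _ a1 _ b1) (hsep _ a2 _ b1))
    (hgen _ _ _ (hinj i j hij u hu) (hsep _ a1 _ b2) (hsep _ a2 _ b2))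
    (hgen _ _ _ (hinj k l hkl v hv) (hsep _ a1 _ b1).symm (hsep _ a1 _ b2).symm)
    (hgen _ _ _ (hinj k l hkl v hv) (hsep _ a2 _ b1).symm (hsep _ a2 _ b2).symm)
  exact Set.disjoint_left.1 hd hz1 hz2

/-! ### Weakly planar graphs are sparse -/

open Finset

section Density

variable {V : Type*}

/-- The graph obtained from `K` by contracting `y` into `x`. -/
def contract (K : SimpleGraph V) (x y : V) : SimpleGraph V where
  Adj a b := a ≠ b ∧ a ≠ y ∧ b ≠ y ∧ (K.Adj a b ∨ (a = x ∧ K.Adj y b) ∨ (b = x ∧ K.Adj a y))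
  symm := ⟨by
    rintro a b ⟨h1, h2, h3, h4⟩
    refine ⟨h1.symm, h3, h2, ?_⟩
    rcases h4 with h | ⟨h, h'⟩ | ⟨h, h'⟩
    · exact .inl h.symm
    · exact .inr (.inr ⟨h, h'.symm⟩)
    · exact .inr (.inl ⟨h, h'.symm⟩)⟩
  loopless := ⟨fun _ h => h.1 rfl⟩

/-- An edge moved from `y` to `x` follows the curve of `x y` first. Overlaps with other edges at `x`
are allowed, and of two edges without a common end at most one contains `x`, so at most one is
lengthened. -/
theorem WeaklyPlanar.contract {K : SimpleGraph V} (hK : WeaklyPlanar K) {x y : V}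
    (hxy : K.Adj x y) : WeaklyPlanar (contract K x y) := by
  classical
  obtain ⟨p, Z, h1, h2⟩ := hK
  have hex : ∀ a b, ∃ W : Set Plane, (ImproperColoring.contract K x y).Adj a b →
      PolyJoined W (p a) (p b) ∧ ((K.Adj a b ∧ W = Z a b) ∨
        (a = x ∧ K.Adj y b ∧ W = Z x y ∪ Z y b) ∨ (b = x ∧ K.Adj a y ∧ W = Z a y ∪ Z y x)) := by
    intro a b
    by_cases hab : (ImproperColoring.contract K x y).Adj a b
    · rcases hab.2.2.2 with h | ⟨rfl, h⟩ | ⟨rfl, h⟩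
      · exact ⟨Z a b, fun _ => ⟨h1 a b h, .inl ⟨h, rfl⟩⟩⟩
      · exact ⟨Z a y ∪ Z y b, fun _ => ⟨((h1 a y hxy).mono Set.subset_union_left).trans
          ((h1 y b h).mono Set.subset_union_right), .inr (.inl ⟨rfl, h, rfl⟩)⟩⟩
      · exact ⟨Z a y ∪ Z y b, fun _ => ⟨((h1 a y h).mono Set.subset_union_left).trans
          ((h1 y b hxy.symm).mono Set.subset_union_right), .inr (.inr ⟨rfl, h, rfl⟩)⟩⟩
    · exact ⟨∅, fun h => absurd h hab⟩
  choose W hW using hex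
  refine ⟨p, W, fun a b hab => (hW a b hab).1, fun a b c d hab hcd hac had hbc hbd => ?_⟩
  obtain ⟨-, hay, hby, -⟩ := id hab
  obtain ⟨-, hcy, hdy, -⟩ := id hcd
  have hyx := hxy.symm
  rcases (hW a b hab).2 with ⟨h, e⟩ | ⟨rfl, h, e⟩ | ⟨rfl, h, e⟩ <;>
  rcases (hW c d hcd).2 with ⟨h', e'⟩ | ⟨rfl, h', e'⟩ | ⟨rfl, h', e'⟩ <;>
  rw [e, e'] <;> (try contradiction) <;>
  (try simp only [Set.disjoint_union_left, Set.disjoint_union_right]) <;>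
  (try constructor) <;> apply h2 <;> first | assumption | (apply Ne.symm; assumption)

open Classical in
/-- The ordered pairs of adjacent vertices in `U`. -/
noncomputable def adjPairs (K : SimpleGraph V) (U : Finset V) : Finset (V × V) :=
  {e ∈ U ×ˢ U | K.Adj e.1 e.2}

@[simp]
theorem mem_adjPairs {K : SimpleGraph V} {U : Finset V} {e : V × V} :
    e ∈ adjPairs K U ↔ (e.1 ∈ U ∧ e.2 ∈ U) ∧ K.Adj e.1 e.2 := by
  simp [adjPairs]

open Classical in
/-- The common neighbours of `x` and `y` in `U`. -/
noncomputable def commonIn (K : SimpleGraph V) (U : Finset V) (x y : V) : Finset V :=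
  {z ∈ U | K.Adj x z ∧ K.Adj y z}

variable [DecidableEq V]

/-- Contraction destroys the edge `x y` and merges `x z` with `y z` for every common neighbour `z`;
the factor 2 accounts for ordered pairs. The set `bad` consists of the lost pairs at `y`. -/
theorem card_adjPairs_le_contract {K : SimpleGraph V} {U : Finset V} {x y : V} (hx : x ∈ U)
    (hxy : K.Adj x y) :
    #(adjPairs K U) ≤ #(adjPairs (contract K x y) (U.erase y)) + 2 * (1 + #(commonIn K U x y)) := by
  classical
  let T := insert x (commonIn K U x y)
  let bad : Finset (V × V) := T.image (fun z => (y, z)) ∪ T.image (fun z => (z, y))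
  have hbad : #bad ≤ 2 * (1 + #(commonIn K U x y)) := by
    have hT : #T ≤ #(commonIn K U x y) + 1 := card_insert_le _ _
    have h1 : #(T.image (fun z => (y, z))) ≤ #T := card_image_le
    have h2 : #(T.image (fun z => (z, y))) ≤ #T := card_image_le
    have h3 : #bad ≤ _ := card_union_le _ _
    omega
  have hmem : ∀ e ∈ adjPairs K U \ bad, e.1 ∈ U ∧ e.2 ∈ U ∧ K.Adj e.1 e.2 ∧
      (e.1 = y → e.2 ≠ x ∧ ¬ K.Adj x e.2) ∧ (e.2 = y → e.1 ≠ x ∧ ¬ K.Adj x e.1) := by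
    rintro ⟨a, b⟩ he
    simp only [mem_sdiff, mem_adjPairs, bad, mem_union, mem_image, not_or, T, mem_insert,
      commonIn, mem_filter, Prod.mk.injEq, not_exists, not_and] at he
    obtain ⟨⟨⟨ha, hb⟩, hab⟩, h1, h2⟩ := he
    refine ⟨ha, hb, hab, ?_, ?_⟩
    · rintro rfl
      exact ⟨fun h => h1 b (.inl h) rfl rfl, fun h => h1 b (.inr ⟨hb, h, hab⟩) rfl rfl⟩
    · rintro rfl
      exact ⟨fun h => h2 a (.inl h) rfl rfl, fun h => h2 a (.inr ⟨ha, h, hab.symm⟩) rfl rfl⟩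
  have hne := hxy.ne
  have hinj : #(adjPairs K U \ bad) ≤ #(adjPairs (contract K x y) (U.erase y)) := by
    refine card_le_card_of_injOn
      (fun e => (if e.1 = y then x else e.1, if e.2 = y then x else e.2)) ?_ ?_
    · rintro ⟨a, b⟩ he
      obtain ⟨ha, hb, hab, h1, h2⟩ := hmem _ he
      have := hab.ne
      simp only [SetLike.mem_coe, mem_adjPairs, mem_erase, contract]
      dsimp only at *
      split_ifs with hay hby hby
      · exact absurd (hay.trans hby.symm) this
      · subst hay
        exact ⟨⟨⟨hne, hx⟩, hby, hb⟩, (h1 rfl).1.symm, hne, hby, .inr (.inl ⟨rfl, hab⟩)⟩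
      · subst hby
        exact ⟨⟨⟨hay, ha⟩, hne, hx⟩, (h2 rfl).1, hay, hne, .inr (.inr ⟨rfl, hab⟩)⟩
      · exact ⟨⟨⟨hay, ha⟩, hby, hb⟩, this, hay, hby, .inl hab⟩
    · rintro ⟨a, b⟩ he ⟨c, d⟩ he' h
      obtain ⟨ha, hb, hab, h1, h2⟩ := hmem _ he
      obtain ⟨hc, hd, hcd, h3, h4⟩ := hmem _ he'
      simp only [Prod.mk.injEq] at h ⊢
      dsimp only at *
      have := hab.ne
      have := hcd.ne
      have := hab.symm
      have := hcd.symm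
      grind
  have := le_card_sdiff bad (adjPairs K U)
  omega

/-- `Q` is a clique of `K` disjoint from `U` whose vertices are adjacent to all of `U`. -/
structure IsApexClique (K : SimpleGraph V) (Q U : Finset V) : Prop where
  disjoint : Disjoint Q U
  adj : ∀ a ∈ Q, ∀ b ∈ Q ∪ U, a ≠ b → K.Adj a b

theorem IsApexClique.contract {K : SimpleGraph V} {Q U : Finset V} (h : IsApexClique K Q U)
    {x y : V} (hy : y ∈ U) : IsApexClique (contract K x y) Q (U.erase y) where
  disjoint := h.disjoint.mono_right (erase_subset _ _)
  adj a ha b hb hab := by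
    have hQ : ∀ c ∈ Q, c ≠ y := fun c hc hcy => disjoint_left.1 h.disjoint hc (hcy ▸ hy)
    refine ⟨hab, hQ a ha, ?_, .inl (h.adj a ha b ?_ hab)⟩
    · rcases mem_union.1 hb with hb | hb
      · exact hQ b hb
      · exact ne_of_mem_erase hb
    · exact union_subset_union_right (erase_subset _ _) hb

/-- `c` is a density that cannot be reached in the neighbourhood of a clique of size `q`. -/
def IsDensityBound (V : Type*) [DecidableEq V] (q c : ℕ) : Prop :=
  ∀ (K : SimpleGraph V) (Q U : Finset V), WeaklyPlanar K → IsApexClique K Q U → #Q = q →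
    U.Nonempty → #(adjPairs K U) < 2 * c * #U

/-- An edge inside `U` together with the three vertices of `Q` would span a `K_5`, so `U` spans no
edge at all. -/
theorem isDensityBound_three : IsDensityBound V 3 1 := by
  intro K Q U hK hQ hcard hU
  by_contra! h
  have hpos : 0 < #(adjPairs K U) := lt_of_lt_of_le (by have := hU.card_pos; omega) h
  obtain ⟨⟨x, y⟩, he⟩ := card_pos.1 hpos
  rw [mem_adjPairs] at he
  obtain ⟨⟨hx, hy⟩, hxy⟩ := he
  dsimp only at hx hy hxy
  obtain ⟨a, b, c, hab, hac, hbc, rfl⟩ := card_eq_three.1 hcard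
  have hne : ∀ u ∈ ({a, b, c} : Finset V), ∀ v ∈ U, u ≠ v := fun u hu v hv huv =>
    disjoint_left.1 hQ.disjoint hu (huv ▸ hv)
  have hadj := hQ.adj
  obtain ⟨p, Z, h1, h2⟩ := hK
  let f : Fin 5 → V := ![a, b, c, x, y]
  have hf : ∀ i j, i ≠ j → K.Adj (f i) (f j) := by
    have ha : a ∈ ({a, b, c} : Finset V) := by simp
    have hb : b ∈ ({a, b, c} : Finset V) := by simp
    have hc : c ∈ ({a, b, c} : Finset V) := by simp
    have lt : ∀ i j, i < j → K.Adj (f i) (f j) := by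
      intro i j hij
      fin_cases i <;> fin_cases j <;> simp [f] at hij ⊢
      · exact hadj a ha b (mem_union_left _ hb) hab
      · exact hadj a ha c (mem_union_left _ hc) hac
      · exact hadj a ha x (mem_union_right _ hx) (hne a ha x hx)
      · exact hadj a ha y (mem_union_right _ hy) (hne a ha y hy)
      · exact hadj b hb c (mem_union_left _ hc) hbc
      · exact hadj b hb x (mem_union_right _ hx) (hne b hb x hx)
      · exact hadj b hb y (mem_union_right _ hy) (hne b hb y hy)
      · exact hadj c hc x (mem_union_right _ hx) (hne c hc x hx)
      · exact hadj c hc y (mem_union_right _ hy) (hne c hc y hy)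
      · exact hxy
    intro i j hij
    rcases lt_or_gt_of_ne hij with h | h
    · exact lt i j h
    · exact (lt j i h).symm
  have hfne : ∀ i j, i ≠ j → f i ≠ f j := fun i j hij => (hf i j hij).ne
  exact not_weaklyPlanar_top_five ⟨p ∘ f, fun i j => Z (f i) (f j),
    fun i j hij => h1 _ _ (hf i j hij),
    fun i j k l hij hkl hik hil hjk hjl => h2 _ _ _ _ (hf i j hij) (hf k l hkl)
      (hfne _ _ hik) (hfne _ _ hil) (hfne _ _ hjk) (hfne _ _ hjl)⟩

/-- Mader's argument on a smallest counterexample. If an edge in `U` has fewer than `2 * c` common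
neighbours in `U`, contracting it loses at most `4 * c` ordered pairs and one vertex, so the density
persists. Otherwise the neighbourhood `N` of any non-isolated `x` in `U` has minimum degree at least
`2 * c`, and `x` can be added to the clique, against the bound for `q + 1`. -/
theorem IsDensityBound.double {q c : ℕ} (hc : 0 < c) (h : IsDensityBound V (q + 1) c) :
    IsDensityBound V q (2 * c) := by
  classical
  intro K Q U
  induction hn : #U using Nat.strong_induction_on generalizing K U with
  | _ n ih =>
  subst hn
  intro hK hQ hcard hU
  by_contra! hge
  by_cases hex : ∃ x ∈ U, ∃ y ∈ U, K.Adj x y ∧ #(commonIn K U x y) < 2 * c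
  · obtain ⟨x, hx, y, hy, hxy, hlt⟩ := hex
    have hle := card_adjPairs_le_contract hx hxy
    have hcU : #(U.erase y) + 1 = #U := card_erase_add_one hy
    have := ih _ (by omega) _ (U.erase y) rfl (hK.contract hxy) (hQ.contract hy) hcard
      ⟨x, mem_erase.2 ⟨hxy.ne, hx⟩⟩
    rw [← hcU] at hge
    have e : 2 * (2 * c) * (#(U.erase y) + 1) = 2 * (2 * c) * #(U.erase y) + 4 * c := by ring
    omega
  · push Not at hex
    have hpos : 0 < #(adjPairs K U) :=
      lt_of_lt_of_le (by have := hU.card_pos; positivity) hge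
    obtain ⟨⟨x, y⟩, he⟩ := card_pos.1 hpos
    rw [mem_adjPairs] at he
    obtain ⟨⟨hx, hy⟩, hxy⟩ := he
    dsimp only at hx hy hxy
    let N : Finset V := {z ∈ U | K.Adj x z}
    have hxQ : x ∉ Q := fun hxQ => disjoint_left.1 hQ.disjoint hxQ hx
    have hxN : x ∉ N := by simp [N]
    have hNU : N ⊆ U := filter_subset _ _
    have hQ' : IsApexClique K (insert x Q) N := by
      refine ⟨disjoint_insert_left.2 ⟨hxN, hQ.disjoint.mono_right hNU⟩, ?_⟩
      intro a ha b hb hab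
      rcases mem_insert.1 ha with rfl | ha
      · rcases mem_union.1 hb with hb | hb
        · have hb := (mem_insert.1 hb).resolve_left hab.symm
          exact (hQ.adj b hb a (mem_union_right _ hx) hab.symm).symm
        · exact (mem_filter.1 hb).2
      · refine hQ.adj a ha b ?_ hab
        rcases mem_union.1 hb with hb | hb
        · rcases mem_insert.1 hb with rfl | hb
          · exact mem_union_right _ hx
          · exact mem_union_left _ hb
        · exact mem_union_right _ (hNU hb)
    have hlt := h K (insert x Q) N hK hQ' (by rw [card_insert_of_notMem hxQ, hcard])
      ⟨y, mem_filter.2 ⟨hy, hxy⟩⟩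
    have hge' : #N * (2 * c) ≤ #(adjPairs K N) := by
      have hfib : ∀ z ∈ N, 2 * c ≤ #{e ∈ adjPairs K N | e.1 = z} := by
        intro z hz
        obtain ⟨hzU, hxz⟩ := mem_filter.1 hz
        refine (hex x hx z hzU hxz).trans ?_
        refine card_le_card_of_injOn (fun w => (z, w)) ?_ ?_
        · intro w hw
          simp only [commonIn, coe_filter, Set.mem_ofPred_eq] at hw
          simp [N, hw.1, hw.2.1, hw.2.2, hzU, hxz]
        · intro w _ w' _ hww
          exact (Prod.mk.inj hww).2
      calc #N * (2 * c) = ∑ z ∈ N, 2 * c := by simp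
        _ ≤ ∑ z ∈ N, #{e ∈ adjPairs K N | e.1 = z} := sum_le_sum hfib
        _ = #(adjPairs K N) := (card_eq_sum_card_fiberwise fun e he =>
            (mem_adjPairs.1 he).1.1).symm
    rw [mul_comm] at hge'
    omega

/-- A weakly planar graph has fewer than `8 |U|` edges inside a nonempty set `U` of vertices. -/
theorem WeaklyPlanar.card_adjPairs_lt {K : SimpleGraph V} (hK : WeaklyPlanar K) {U : Finset V}
    (hU : U.Nonempty) : #(adjPairs K U) < 16 * #U := by
  -- Three doublings lead from cliques of size 3 down to the empty clique.
  have h : IsDensityBound V 0 (2 * (2 * (2 * 1))) :=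
    ((isDensityBound_three.double (by omega)).double (by omega)).double (by omega)
  exact h K ∅ U hK ⟨disjoint_empty_left _, by simp⟩ rfl hU

end Density

/-! ### Colouring planar graphs without four-cycles and graphs without odd cycles -/

section Upper

variable {V : Type*}

/-- Every vertex has at most `D` neighbours of its own color. -/
def HasDefect (G : SimpleGraph V) (c : V → Fin 2) (D : ℕ) : Prop :=
  ∀ v, {w | G.Adj v w ∧ c w = c v}.ncard ≤ D

theorem ncard_neighborSet_induce (G : SimpleGraph V) (c : V → Fin 2) (i : Fin 2)
    (v : {v | c v = i}) :
    ((G.induce {v | c v = i}).neighborSet v).ncard = {w | G.Adj v w ∧ c w = c v}.ncard := by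
  rw [← Set.ncard_image_of_injective _ Subtype.val_injective]
  congr 1
  ext w
  have hv : c v = i := v.2
  simp [hv, and_comm]

theorem isDefectiveColorable_iff {V : Type} [Finite V] {G : SimpleGraph V} {D : ℕ} :
    IsDefectiveColorable G (fun _ : Fin 2 => D) ↔ ∃ c : V → Fin 2, HasDefect G c D := by
  refine exists_congr fun c => ⟨fun h v => ?_, fun h i v => ?_⟩
  · rw [← ncard_neighborSet_induce G c (c v) ⟨v, rfl⟩]
    exact h (c v) ⟨v, rfl⟩
  · rw [ncard_neighborSet_induce]
    exact h v

theorem cycleGraph_four_isContained {G : SimpleGraph V} {a b a' b' : V} (ha : a ≠ a')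
    (hb : b ≠ b') (h1 : G.Adj a b) (h2 : G.Adj a b') (h3 : G.Adj a' b) (h4 : G.Adj a' b') :
    (SimpleGraph.cycleGraph 4).IsContained G := by
  rw [SimpleGraph.cycleGraph_isContained_iff (by norm_num)]
  refine ⟨a, .cons h1 (.cons h3.symm (.cons h4 (.cons h2.symm .nil))), ?_, rfl⟩
  rw [SimpleGraph.Walk.isCycle_iff_isPath_tail_and_le_length]
  refine ⟨?_, by simp⟩
  simp [SimpleGraph.Walk.isPath_def, h3.ne', hb, h1.ne', h4.ne, ha.symm, h2.ne']

variable [Fintype V]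

/-- In a weakly planar graph without four-cycles in which no vertex has degree one, some edge has
two ends of bounded degree. -/
theorem WeaklyPlanar.exists_light_edge {H : SimpleGraph V} (hH : WeaklyPlanar H)
    (h4 : ¬ (SimpleGraph.cycleGraph 4).IsContained H) (hne : ∃ x y, H.Adj x y)
    (hdeg : ∀ v, (H.neighborSet v).ncard ≠ 1) :
    ∃ x y, H.Adj x y ∧ (H.neighborSet x).ncard ≤ 272 ∧ (H.neighborSet y).ncard ≤ 272 := by
  classical
  -- The constant is `272 = 16 * 17`, from `#A < 16 * #B` and fewer than `16 * (#A + #B)` ordered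
  -- adjacent pairs in `A ∪ B`.
  by_contra! hcon
  let A : Finset V := {v | 2 ≤ (H.neighborSet v).ncard ∧ (H.neighborSet v).ncard ≤ 272}
  let B : Finset V := {v | 272 < (H.neighborSet v).ncard}
  have hAB : ∀ a ∈ A, a ∉ B := by
    intro a ha hb
    simp only [A, B, mem_filter, mem_univ, true_and] at ha hb
    omega
  have hpos : ∀ {x y}, H.Adj x y → 2 ≤ (H.neighborSet x).ncard := by
    intro x y hxy
    have h0 : 0 < (H.neighborSet x).ncard := (Set.ncard_pos (Set.toFinite _)).2 ⟨y, hxy⟩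
    have := hdeg x
    omega
  have hmem : ∀ {x y}, H.Adj x y → x ∈ A ∪ B := by
    intro x y hxy
    have := hpos hxy
    simp only [A, B, mem_union, mem_filter, mem_univ, true_and]
    omega
  have hAnb : ∀ {a b}, a ∈ A → H.Adj a b → b ∈ B := by
    intro a b ha hab
    simp only [A, B, mem_filter, mem_univ, true_and] at ha ⊢
    exact hcon a b hab ha.2
  have hB : B.Nonempty := by
    obtain ⟨x, y, hxy⟩ := hne
    rcases mem_union.1 (hmem hxy) with h | h
    · exact ⟨y, hAnb h hxy⟩
    · exact ⟨x, h⟩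
  have hex : ∀ a, ∃ b b', a ∈ A → b ≠ b' ∧ H.Adj a b ∧ H.Adj a b' := by
    intro a
    by_cases ha : a ∈ A
    · have h2 : 1 < (H.neighborSet a).ncard := by
        simp only [A, mem_filter, mem_univ, true_and] at ha
        omega
      obtain ⟨b, b', hb, hb', hbb⟩ := (Set.one_lt_ncard_iff (Set.toFinite _)).1 h2
      exact ⟨b, b', fun _ => ⟨hbb, hb, hb'⟩⟩
    · exact ⟨a, a, fun h => absurd h ha⟩
  choose f g hfg using hex
  -- Each `a ∈ A` is replaced by an edge between two of its neighbours in `B`, drawn through `a`.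
  let K : SimpleGraph V :=
    { Adj := fun x y => ∃ a ∈ A, (x = f a ∧ y = g a) ∨ (x = g a ∧ y = f a)
      symm := ⟨fun x y ⟨a, ha, h⟩ => ⟨a, ha, h.symm.imp And.symm And.symm⟩⟩
      loopless := ⟨by
        rintro x ⟨a, ha, ⟨h1, h2⟩ | ⟨h1, h2⟩⟩
        · exact (hfg a ha).1 (h1.symm.trans h2)
        · exact (hfg a ha).1 (h2.symm.trans h1)⟩ }
  have hK : WeaklyPlanar K := by
    obtain ⟨p, Z, h1, h2⟩ := hH
    have hex : ∀ x y, ∃ a, K.Adj x y → a ∈ A ∧ H.Adj x a ∧ H.Adj a y ∧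
        ((x = f a ∧ y = g a) ∨ (x = g a ∧ y = f a)) := by
      intro x y
      by_cases hxy : K.Adj x y
      · obtain ⟨a, ha, h⟩ := hxy
        refine ⟨a, fun _ => ⟨ha, ?_, ?_, h⟩⟩
        · rcases h with ⟨rfl, rfl⟩ | ⟨rfl, rfl⟩
          · exact (hfg a ha).2.1.symm
          · exact (hfg a ha).2.2.symm
        · rcases h with ⟨rfl, rfl⟩ | ⟨rfl, rfl⟩
          · exact (hfg a ha).2.2
          · exact (hfg a ha).2.1
      · exact ⟨x, fun h => absurd h hxy⟩
    choose m hm using hex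
    refine ⟨p, fun x y => Z x (m x y) ∪ Z (m x y) y, fun x y hxy => ?_, ?_⟩
    · obtain ⟨-, ha, hb, -⟩ := hm x y hxy
      exact ((h1 _ _ ha).mono Set.subset_union_left).trans
        ((h1 _ _ hb).mono Set.subset_union_right)
    · intro x y x' y' hxy hxy' n1 n2 n3 n4
      obtain ⟨hA, ha, hb, hc⟩ := hm x y hxy
      obtain ⟨hA', ha', hb', hc'⟩ := hm x' y' hxy'
      -- The middle vertex determines the unordered pair of ends, so edges of `K` without a common
      -- end run through different vertices of `A`.
      have hmm : m x y ≠ m x' y' := by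
        intro h
        rw [h] at hc
        grind
      have q1 : ∀ {z}, z ∈ B → m x y ≠ z := fun hz h => hAB _ hA (h ▸ hz)
      have q2 : ∀ {z}, z ∈ B → z ≠ m x' y' := fun hz h => hAB _ hA' (h ▸ hz)
      have hxB := hAnb hA ha.symm
      have hyB := hAnb hA hb
      have hxB' := hAnb hA' ha'.symm
      have hyB' := hAnb hA' hb'
      simp only [Set.disjoint_union_left, Set.disjoint_union_right]
      exact ⟨⟨h2 _ _ _ _ ha ha' n1 (q2 hxB) (q1 hxB') hmm,
        h2 _ _ _ _ hb ha' (q1 hxB') hmm n3 (q2 hyB)⟩,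
        h2 _ _ _ _ ha hb' (q2 hxB) n2 hmm (q1 hyB'),
        h2 _ _ _ _ hb hb' hmm (q1 hyB') (q2 hyB) n4⟩
  have hA : #A ≤ #(adjPairs K B) := by
    refine card_le_card_of_injOn (fun a => (f a, g a)) ?_ ?_
    · intro a ha
      simp only [SetLike.mem_coe, mem_adjPairs]
      exact ⟨⟨hAnb ha (hfg a ha).2.1, hAnb ha (hfg a ha).2.2⟩, a, ha, .inl ⟨rfl, rfl⟩⟩
    · intro a ha a' ha' h
      obtain ⟨h1, h2⟩ := Prod.mk.inj h
      by_contra hne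
      -- Two vertices of `A` with the same chosen neighbours would be opposite corners of a
      -- four-cycle.
      refine h4 (cycleGraph_four_isContained hne (hfg a ha).1 (hfg a ha).2.1 (hfg a ha).2.2 ?_ ?_)
      · rw [h1]; exact (hfg a' ha').2.1
      · rw [h2]; exact (hfg a' ha').2.2
  have hA' := hK.card_adjPairs_lt hB
  have hH' := hH.card_adjPairs_lt (U := A ∪ B) (hB.mono subset_union_right)
  have hcard := card_union_le A B
  have hlow : #B * 272 ≤ #(adjPairs H (A ∪ B)) := by
    have hfib : ∀ b ∈ B, 272 ≤ #{e ∈ adjPairs H (A ∪ B) | e.1 = b} := by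
      intro b hb
      have hb' : 272 < (H.neighborSet b).ncard := by simpa [B] using hb
      rw [Set.ncard_eq_toFinset_card'] at hb'
      refine hb'.le.trans (card_le_card_of_injOn (fun w => (b, w)) ?_ ?_)
      · intro w hw
        have hw : H.Adj b w := by simpa using hw
        simp only [coe_filter, mem_adjPairs, Set.mem_ofPred_eq]
        exact ⟨⟨⟨mem_union_right _ hb, hmem hw.symm⟩, hw⟩, trivial⟩
      · intro w _ w' _ hww
        exact (Prod.mk.inj hww).2
    calc #B * 272 = ∑ b ∈ B, 272 := by simp
      _ ≤ ∑ b ∈ B, #{e ∈ adjPairs H (A ∪ B) | e.1 = b} := sum_le_sum hfib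
      _ ≤ ∑ b ∈ A ∪ B, #{e ∈ adjPairs H (A ∪ B) | e.1 = b} :=
          sum_le_sum_of_subset subset_union_right
      _ = #(adjPairs H (A ∪ B)) := (card_eq_sum_card_fiberwise fun e he =>
            (mem_adjPairs.1 he).1.1).symm
  omega

/-- Induction on the number of edges: an edge at a vertex of degree one, or else a light edge, is
deleted and the colouring of the rest is extended. -/
theorem WeaklyPlanar.exists_hasDefect {H : SimpleGraph V} (hH : WeaklyPlanar H)
    (h4 : ¬ (SimpleGraph.cycleGraph 4).IsContained H) :
    ∃ c : V → Fin 2, HasDefect H c 272 := by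
  classical
  induction hn : H.edgeSet.ncard using Nat.strong_induction_on generalizing H with
  | _ n ih =>
  subst hn
  by_cases hne : ∃ x y, H.Adj x y
  swap
  · push Not at hne
    exact ⟨fun _ => 0, fun v => by simp [hne]⟩
  have hdel : ∀ x y, H.Adj x y → ∃ c : V → Fin 2, HasDefect (H.deleteEdges {s(x, y)}) c 272 := by
    intro x y hxy
    have hle : H.deleteEdges {s(x, y)} ≤ H := SimpleGraph.deleteEdges_le _
    refine ih _ ?_ (hH.mono hle) (fun h => h4 (h.mono_right hle)) rfl
    refine Set.ncard_lt_ncard ?_ (Set.toFinite _)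
    rw [SimpleGraph.edgeSet_ssubset_edgeSet]
    refine lt_of_le_of_ne hle fun h => ?_
    rw [← h] at hxy
    simp at hxy
  by_cases hdeg : ∃ v, (H.neighborSet v).ncard = 1
  · obtain ⟨x, hx⟩ := hdeg
    obtain ⟨y, hy⟩ := Set.ncard_eq_one.1 hx
    have hxy : ∀ z, H.Adj x z ↔ z = y := fun z => by
      rw [← SimpleGraph.mem_neighborSet, hy, Set.mem_singleton_iff]
    have hne : x ≠ y := ((hxy y).2 rfl).ne
    obtain ⟨c, hc⟩ := hdel x y ((hxy y).2 rfl)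
    refine ⟨Function.update c x (c y + 1), fun v => ?_⟩
    have hflip : ∀ i : Fin 2, i + 1 ≠ i := by decide
    by_cases hv : v = x
    · subst hv
      have : {w | H.Adj v w ∧ Function.update c v (c y + 1) w =
          Function.update c v (c y + 1) v} = ∅ := by
        ext w
        simp only [hxy, Function.update_self, Set.mem_ofPred_eq, Set.mem_empty_iff_false, iff_false,
          not_and]
        rintro rfl
        rw [Function.update_of_ne hne.symm]
        exact (hflip _).symm
      rw [this]
      simp
    · refine le_trans (Set.ncard_le_ncard ?_ (Set.toFinite _)) (hc v)
      rintro w ⟨hvw, hw⟩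
      rw [Function.update_of_ne hv] at hw
      by_cases hwx : w = x
      · subst hwx
        obtain rfl := (hxy v).1 hvw.symm
        rw [Function.update_self] at hw
        exact absurd hw (hflip _)
      · rw [Function.update_of_ne hwx] at hw
        refine ⟨?_, hw⟩
        rw [SimpleGraph.deleteEdges_adj]
        refine ⟨hvw, ?_⟩
        simp [hv, hwx]
  · push Not at hdeg
    obtain ⟨x, y, hxy, hx, hy⟩ := hH.exists_light_edge h4 hne hdeg
    obtain ⟨c, hc⟩ := hdel x y hxy
    refine ⟨c, fun v => ?_⟩
    -- Restoring the edge affects only `x` and `y`, whose whole degree is already within the bound.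
    have light : (H.neighborSet v).ncard ≤ 272 → {w | H.Adj v w ∧ c w = c v}.ncard ≤ 272 :=
      fun h => le_trans (Set.ncard_le_ncard (fun w hw => hw.1) (Set.toFinite _)) h
    by_cases hvx : v = x
    · exact light (hvx ▸ hx)
    by_cases hvy : v = y
    · exact light (hvy ▸ hy)
    refine le_trans (Set.ncard_le_ncard ?_ (Set.toFinite _)) (hc v)
    rintro w ⟨hvw, hw⟩
    refine ⟨?_, hw⟩
    rw [SimpleGraph.deleteEdges_adj]
    refine ⟨hvw, ?_⟩
    simp [hvx, hvy]

end Upper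

/-! ### Odd closed walks and bipartiteness -/

theorem exists_odd_cycle_of_odd_closed_walk {V : Type*} {G : SimpleGraph V} {u : V}
    (w : G.Walk u u) (hw : Odd w.length) :
    ∃ (v : V) (c : G.Walk v v), c.IsCycle ∧ Odd c.length := by
  induction hn : w.length using Nat.strong_induction_on generalizing u w with
  | _ n ih =>
  subst hn
  by_cases hinj : Set.InjOn w.tail.getVert {i | i ≤ w.tail.length}
  · refine ⟨u, w, ?_, hw⟩
    rw [SimpleGraph.Walk.isCycle_iff_isPath_tail_and_le_length]
    refine ⟨(SimpleGraph.Walk.IsPath.getVert_injOn_iff _).1 hinj, ?_⟩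
    have h1 : w.length ≠ 1 := fun h => (SimpleGraph.Walk.adj_of_length_eq_one h).ne rfl
    obtain ⟨k, hk⟩ := hw
    omega
  -- A repeated vertex splits the walk into two closed walks, one of them odd. Position 0 is left
  -- out, so the common end of the walk is not counted as a repetition and both pieces are strictly
  -- shorter.
  · obtain ⟨a, b, ha, hab, hb, heq⟩ : ∃ a b, 1 ≤ a ∧ a < b ∧ b ≤ w.length ∧
        w.getVert a = w.getVert b := by
      have hlen : w.tail.length + 1 = w.length :=
        SimpleGraph.Walk.length_tail_add_one (by
          rw [SimpleGraph.Walk.not_nil_iff_lt_length]; exact hw.pos)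
      simp only [Set.InjOn, not_forall] at hinj
      obtain ⟨i, hi, j, hj, hij, hne⟩ := hinj
      simp only [Set.mem_ofPred_eq, SimpleGraph.Walk.getVert_tail] at hi hj hij
      rcases lt_or_gt_of_ne hne with h | h
      · exact ⟨i + 1, j + 1, by omega, by omega, by omega, hij⟩
      · exact ⟨j + 1, i + 1, by omega, by omega, by omega, hij.symm⟩
    let inner := ((w.drop a).take (b - a)).copy rfl
      (by rw [SimpleGraph.Walk.drop_getVert, Nat.add_sub_cancel' hab.le, ← heq] :
        (w.drop a).getVert (b - a) = w.getVert a)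
    let outer := (w.take a).append ((w.drop b).copy heq.symm rfl)
    have h1 : inner.length = b - a := by
      simp [inner, SimpleGraph.Walk.take_length, SimpleGraph.Walk.drop_length]
      omega
    have h2 : outer.length = a + (w.length - b) := by
      simp [outer, SimpleGraph.Walk.take_length, SimpleGraph.Walk.drop_length]
      omega
    rcases Nat.even_or_odd inner.length with h | h
    · refine ih outer.length (by omega) outer ?_ rfl
      rw [← Nat.not_even_iff_odd] at hw ⊢
      intro h'
      apply hw
      have : w.length = inner.length + outer.length := by omega
      rw [this]
      exact h.add h'
    · exact ih inner.length (by omega) inner h rfl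

theorem colorable_two_of_forall_odd {V : Type*} {G : SimpleGraph V}
    (h : ∀ k, 3 ≤ k → Odd k → ¬ (SimpleGraph.cycleGraph k).IsContained G) : G.Colorable 2 := by
  rw [SimpleGraph.two_colorable_iff_forall_loop_even]
  intro u w
  by_contra hw
  rw [Nat.not_even_iff_odd] at hw
  obtain ⟨v, c, hc, hodd⟩ := exists_odd_cycle_of_odd_closed_walk w hw
  have h3 := hc.three_le_length
  exact h _ h3 hodd ((SimpleGraph.cycleGraph_isContained_iff (by omega)).2 ⟨v, c, hc, rfl⟩)

/-! ### Sufficiency of the two conditions -/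

theorem isBalancedObstructionSet_of_fourCycle_mem {S : Set CycleLength} (hS : fourCycle ∈ S) :
    IsBalancedObstructionSet 2 S := by
  refine ⟨272, fun V _ G hG => ?_⟩
  have := Fintype.ofFinite V
  rw [isDefectiveColorable_iff]
  exact hG.1.weaklyPlanar.exists_hasDefect (hG.2 _ hS)

theorem isBalancedObstructionSet_of_oddCycles_subset {S : Set CycleLength}
    (hS : oddCycles ⊆ S) : IsBalancedObstructionSet 2 S := by
  refine ⟨0, fun V _ G hG => ?_⟩
  rw [isDefectiveColorable_iff]
  obtain ⟨c⟩ := colorable_two_of_forall_odd (G := G) fun k hk hodd =>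
    hG.2 ⟨k, hk⟩ (hS hodd)
  refine ⟨c, fun v => ?_⟩
  have : {w | G.Adj v w ∧ c w = c v} = ∅ := by
    ext w
    simp only [Set.mem_ofPred_eq, Set.mem_empty_iff_false, iff_false, not_and]
    exact fun h h' => c.valid h h'.symm
  rw [this]
  simp

/-! ### Planar graphs with cycles of two lengths only -/

/-- The vertices of the necklace graph: `(0, 0, 0)` is the root, `(2 * t, j, 0)` is the `t`-th bead
of the `j`-th strand, and the vertices `(2 * t + 1, j, m)` are joined to the beads `t` and `t + 1`
of that strand. -/
def IsNecklaceVertex (r D : ℕ) (v : ℕ × ℕ × ℕ) : Prop :=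
  v.1 ≤ 2 * r ∧ v.2.1 ≤ D ∧ v.2.2 ≤ 2 * D ∧ (v.1 % 2 = 0 → v.2.2 = 0) ∧ (v.1 = 0 → v.2.1 = 0)

abbrev NecklaceVertex (r D : ℕ) : Type := {v : ℕ × ℕ × ℕ // IsNecklaceVertex r D v}

instance (r D : ℕ) : Finite (NecklaceVertex r D) := by
  refine Set.Finite.to_subtype (((Set.finite_Iic (2 * r)).prod
    ((Set.finite_Iic D).prod (Set.finite_Iic (2 * D)))).subset ?_)
  rintro ⟨c, j, m⟩ h
  exact ⟨h.1, h.2.1, h.2.2.1⟩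

section Necklace

variable {r D : ℕ}

theorem NecklaceVertex.ext' {u v : NecklaceVertex r D} (h1 : u.1.1 = v.1.1)
    (h2 : u.1.2.1 = v.1.2.1) (h3 : u.1.2.2 = v.1.2.2) : u = v :=
  Subtype.ext (Prod.ext h1 (Prod.ext h2 h3))

/-- `v` is in the column after `u`, and they are on the same strand. -/
def StepUp (u v : NecklaceVertex r D) : Prop :=
  v.1.1 = u.1.1 + 1 ∧ (u.1.1 = 0 ∨ u.1.2.1 = v.1.2.1)

/-- `u` is the root and `v` the last bead of a strand. -/
def ClosesUp (u v : NecklaceVertex r D) : Prop :=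
  u.1.1 = 0 ∧ v.1.1 = 2 * r

/-- The edges of the necklace graph, directed away from the root. -/
def Forward (u v : NecklaceVertex r D) : Prop := StepUp u v ∨ ClosesUp u v

/-- The necklace graph: `D + 1` chains of complete bipartite graphs `K_{2, 2D + 1}`, each chain
made of `r` pieces; they start at the root, and their last vertices are adjacent to the root. -/
def necklace (r D : ℕ) (hr : 0 < r) : SimpleGraph (NecklaceVertex r D) where
  Adj u v := Forward u v ∨ Forward v u
  symm := ⟨fun _ _ h => h.symm⟩
  loopless := ⟨fun u h => by
    simp only [Forward, StepUp, ClosesUp] at h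
    omega⟩

theorem necklace_adj {hr : 0 < r} {u v : NecklaceVertex r D} :
    (necklace r D hr).Adj u v ↔ Forward u v ∨ Forward v u := Iff.rfl

/-- Two vertices between the same beads. -/
def Twins (u w : NecklaceVertex r D) : Prop :=
  u.1.1 = w.1.1 ∧ u.1.2.1 = w.1.2.1 ∧ u.1.1 % 2 = 1

/-- Modulo `2 * r + 1` the closing edge from the root to a last bead is also a step by one column.
In this sense two neighbours of a non-root vertex lie on opposite sides of it, unless they are
middle vertices attached to the same bead on the same side. -/
theorem necklace_progress {hr : 0 < r} {u v w : NecklaceVertex r D}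
    (huv : (necklace r D hr).Adj u v) (hvw : (necklace r D hr).Adj v w) (huw : u ≠ w)
    (hv : v.1.1 ≠ 0) : w.1.1 + u.1.1 = 2 * v.1.1 ∨ w.1.1 + u.1.1 + (2 * r + 1) = 2 * v.1.1 ∨
      Twins u w := by
  have hne : ¬ (u.1.1 = w.1.1 ∧ u.1.2.1 = w.1.2.1 ∧ u.1.2.2 = w.1.2.2) := fun h =>
    huw (NecklaceVertex.ext' h.1 h.2.1 h.2.2)
  obtain ⟨⟨c₁, j₁, m₁⟩, hu⟩ := u
  obtain ⟨⟨c₂, j₂, m₂⟩, hv'⟩ := v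
  obtain ⟨⟨c₃, j₃, m₃⟩, hw⟩ := w
  simp only [IsNecklaceVertex] at hu hv' hw
  simp only [necklace_adj, Forward, StepUp, ClosesUp, Twins] at *
  omega

theorem necklace_adj_odd {hr : 0 < r} {a u : NecklaceVertex r D}
    (hau : (necklace r D hr).Adj a u) (hu : u.1.1 % 2 = 1) :
    (a.1.1 + 1 = u.1.1 ∨ a.1.1 = u.1.1 + 1) ∧ a.1.2.2 = 0 ∧
      ((a.1.1 = 0 ∧ a.1.2.1 = 0) ∨ (a.1.1 ≠ 0 ∧ a.1.2.1 = u.1.2.1)) := by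
  obtain ⟨⟨c₁, j₁, m₁⟩, hu'⟩ := u
  obtain ⟨⟨c₂, j₂, m₂⟩, ha⟩ := a
  simp only [IsNecklaceVertex] at hu' ha
  simp only [necklace_adj, Forward, StepUp, ClosesUp] at *
  omega

/-- A middle vertex has exactly two neighbours, and twins have the same two. -/
theorem necklace_twins_other {hr : 0 < r} {u v w a b : NecklaceVertex r D} (huw : Twins u w)
    (hvu : (necklace r D hr).Adj v u)
    (hau : (necklace r D hr).Adj a u) (hbw : (necklace r D hr).Adj b w) (hav : a ≠ v)
    (hbv : b ≠ v) : a = b := by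
  have hne : ¬ (a.1.1 = v.1.1 ∧ a.1.2.1 = v.1.2.1 ∧ a.1.2.2 = v.1.2.2) := fun h =>
    hav (NecklaceVertex.ext' h.1 h.2.1 h.2.2)
  have hne' : ¬ (b.1.1 = v.1.1 ∧ b.1.2.1 = v.1.2.1 ∧ b.1.2.2 = v.1.2.2) := fun h =>
    hbv (NecklaceVertex.ext' h.1 h.2.1 h.2.2)
  obtain ⟨e1, e2, e3⟩ := huw
  have h1 := necklace_adj_odd hvu e3
  have h2 := necklace_adj_odd hau e3
  have h3 := necklace_adj_odd hbw (e1 ▸ e3)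
  clear hvu hau hbw hav hbv
  have hab : a.1.1 = b.1.1 := by omega
  exact NecklaceVertex.ext' hab (by omega) (by omega)

/-- A copy of a cycle, as a periodic sequence of vertices. -/
theorem exists_periodic_of_cycleGraph_isContained {V : Type*} {G : SimpleGraph V} {k : ℕ}
    (hk : 3 ≤ k) (h : (SimpleGraph.cycleGraph k).IsContained G) :
    ∃ g : ℕ → V, (∀ s, G.Adj (g s) (g (s + 1))) ∧ ∀ s t, g s = g t ↔ s ≡ t [MOD k] := by
  obtain ⟨f⟩ := h
  have hk0 : 0 < k := by omega
  refine ⟨fun s => f ⟨s % k, Nat.mod_lt _ hk0⟩, fun s => f.toHom.map_adj ?_, fun s t => ?_⟩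
  · rw [SimpleGraph.cycleGraph_adj']
    right
    rw [Fin.sub_def]
    have h1 := Nat.mod_lt s hk0
    simp only
    rw [Nat.add_mod s 1 k, Nat.mod_eq_of_lt (by omega : 1 < k)]
    rcases Nat.lt_or_ge (s % k + 1) k with h2 | h2
    · rw [Nat.mod_eq_of_lt h2, show k - s % k + (s % k + 1) = 1 + k by omega, Nat.add_mod_right,
        Nat.mod_eq_of_lt (by omega)]
    · rw [show s % k + 1 = k by omega, Nat.mod_self, Nat.add_zero,
        show k - s % k = 1 by omega, Nat.mod_eq_of_lt (by omega)]
  · constructor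
    · intro h
      exact congrArg Fin.val (f.injective h)
    · intro h
      exact congrArg f (Fin.ext h)

/-- A cycle through twins with a common neighbour closes up after four steps. Any other cycle moves
in one direction through the columns modulo `2 * r + 1` between visits to the root, hence has length
`2 * r + 1`. -/
theorem necklace_cycle_length {hr : 0 < r} {k : ℕ} (hk : 3 ≤ k)
    (h : (SimpleGraph.cycleGraph k).IsContained (necklace r D hr)) : k = 4 ∨ k = 2 * r + 1 := by
  obtain ⟨g, hadj, hg⟩ := exists_periodic_of_cycleGraph_isContained hk h
  have hdvd : ∀ s t, g s = g (s + t) → k ∣ t := by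
    intro s t hst
    have := ((hg _ _).1 hst).symm
    exact (Nat.modEq_zero_iff_dvd).1 (Nat.ModEq.add_left_cancel' s (by simpa using this))
  have hne2 : ∀ s, g s ≠ g (s + 2) := fun s hst => by
    have := Nat.le_of_dvd (by omega) (hdvd s 2 hst)
    omega
  by_cases htw : ∃ s, Twins (g s) (g (s + 2))
  · left
    obtain ⟨s, hs⟩ := htw
    have hper : g (s + k) = g s := (hg _ _).2 (by simp [Nat.ModEq])
    have hper' : g (s + k + 1) = g (s + 1) :=
      (hg _ _).2 (by rw [Nat.add_right_comm]; simp [Nat.ModEq])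
    -- The index `s + k - 1` stands for the predecessor of `s`, also when `s = 0`. It will coincide
    -- with `g (s + 3)`, so that `k` divides 4.
    have h1 : (necklace r D hr).Adj (g (s + k - 1)) (g s) := by
      have := hadj (s + k - 1)
      rwa [show s + k - 1 + 1 = s + k by omega, hper] at this
    have hne : g (s + k - 1) ≠ g (s + 1) := by
      rw [← hper']
      have := hne2 (s + k - 1)
      rwa [show s + k - 1 + 2 = s + k + 1 by omega] at this
    have heq := necklace_twins_other hs (hadj s).symm h1 (hadj (s + 2)).symm hne
      (hne2 (s + 1)).symm
    have heq' : g (s + 3 + k) = g (s + k - 1) := by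
      rw [heq]
      exact (hg _ _).2 (by simp [Nat.ModEq])
    rw [show s + 3 + k = s + k - 1 + 4 by omega] at heq'
    have h4 := hdvd _ _ heq'.symm
    have := Nat.le_of_dvd (by omega) h4
    interval_cases k
    · omega
    · rfl
  · right
    push Not at htw
    let φ : ℕ → ZMod (2 * r + 1) := fun s => ((g s).1.1 : ZMod (2 * r + 1))
    have hstep : ∀ s, (g (s + 1)).1.1 ≠ 0 → φ (s + 2) - φ (s + 1) = φ (s + 1) - φ s := by
      intro s hs
      have key : φ (s + 2) + φ s = 2 * φ (s + 1) := by
        rcases necklace_progress (hadj s) (hadj (s + 1)) (hne2 s) hs with h | h | h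
        · have := congrArg (Nat.cast : ℕ → ZMod (2 * r + 1)) h
          push_cast at this
          exact this
        · have := congrArg (Nat.cast : ℕ → ZMod (2 * r + 1)) h
          have hz : ((2 * r + 1 : ℕ) : ZMod (2 * r + 1)) = 0 := ZMod.natCast_self _
          rw [Nat.cast_add, hz] at this
          push_cast at this
          simpa using this
        · exact absurd h (htw s)
      linear_combination key
    have hε : ∀ s, φ (s + 1) - φ s = 1 ∨ φ (s + 1) - φ s = -1 := by
      intro s
      have hz : ((2 * r + 1 : ℕ) : ZMod (2 * r + 1)) = 0 := ZMod.natCast_self _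
      push_cast at hz
      simp only [φ]
      rcases hadj s with (⟨h, -⟩ | ⟨h, h'⟩) | (⟨h, -⟩ | ⟨h, h'⟩)
      · left; rw [h]; push_cast; ring
      · right; rw [h, h']; push_cast; linear_combination hz
      · right; rw [h]; push_cast; ring
      · left; rw [h, h']; push_cast; linear_combination -hz
    have hzero : ∀ s, φ s = 0 → (g s).1.1 = 0 := by
      intro s hs
      have h1 := (ZMod.natCast_eq_zero_iff _ _).1 hs
      have h2 := (g s).2.1
      by_contra hne
      have := Nat.le_of_dvd (by omega) h1
      omega
    have hroot : ∀ s t, (g s).1.1 = 0 → (g t).1.1 = 0 → g s = g t := by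
      intro s t h1 h2
      have a1 := (g s).2
      have a2 := (g t).2
      simp only [IsNecklaceVertex] at a1 a2
      exact NecklaceVertex.ext' (by omega) (by omega) (by omega)
    have hlin : ∀ a L, (∀ s, 0 < s → s < L → (g (a + s)).1.1 ≠ 0) →
        ∀ s ≤ L, φ (a + s) = φ a + s * (φ (a + 1) - φ a) := by
      intro a L hL
      have hdiff : ∀ s < L, φ (a + s + 1) - φ (a + s) = φ (a + 1) - φ a := by
        intro s
        induction s with
        | zero => intro _; rfl
        | succ s ih =>
          intro hs
          rw [← ih (by omega)]
          exact hstep (a + s) (hL (s + 1) (by omega) hs)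
      intro s
      induction s with
      | zero => intro _; simp
      | succ s ih =>
        intro hs
        have h1 := ih (by omega)
        have h2 := hdiff s (by omega)
        push_cast
        rw [← add_assoc a s 1]
        linear_combination h1 + h2
    -- If the root were avoided, `φ` would be affine with slope `±1` on all of `ℕ`, and such a
    -- sequence takes the value 0.
    obtain ⟨a, ha⟩ : ∃ a, (g a).1.1 = 0 := by
      by_contra! hcon
      have hl : ∀ s, φ (0 + s) = φ 0 + s * (φ (0 + 1) - φ 0) := fun s =>
        hlin 0 s (fun t _ _ => hcon _) s le_rfl
      rcases hε 0 with h | h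
      · have := hl (-φ 0).val
        rw [h, ZMod.natCast_val, ZMod.cast_id] at this
        exact hcon _ (hzero _ (this.trans (by ring)))
      · have := hl (φ 0).val
        rw [h, ZMod.natCast_val, ZMod.cast_id] at this
        exact hcon _ (hzero _ (this.trans (by ring)))
    have hφa : φ a = 0 := by simp [φ, ha]
    have hnz : ∀ s, 0 < s → s < k → (g (a + s)).1.1 ≠ 0 := by
      intro s hs hsk h0
      have := Nat.le_of_dvd hs (hdvd a s (hroot _ _ ha h0))
      omega
    have hk' := hlin a k hnz k le_rfl
    have hper : g (a + k) = g a := (hg _ _).2 (by simp [Nat.ModEq])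
    have hφk : φ (a + k) = 0 := by simp only [φ, hper]; exact hφa
    rw [hφk, hφa, zero_add] at hk'
    have hdk : 2 * r + 1 ∣ k := by
      rw [← ZMod.natCast_eq_zero_iff]
      rcases hε a with h | h <;> rw [hφa] at h <;> rw [h] at hk'
      · simpa using hk'.symm
      · simpa using hk'.symm
    -- Linearity is known only up to index `k`, hence this inequality first. At index `2 * r + 1`
    -- the cycle is back at the root, so `k` also divides `2 * r + 1`.
    have hle := Nat.le_of_dvd (by omega) hdk
    have hr' := hlin a k hnz (2 * r + 1) hle
    rw [ZMod.natCast_self, hφa, zero_mul, zero_add] at hr'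
    have := hdvd a (2 * r + 1) (hroot _ _ ha (hzero _ hr'))
    have := Nat.le_of_dvd (by omega) this
    omega

/-! #### The necklace graph is not colorable with small defect -/

/-- If consecutive beads had different colours, each of the `2 * D + 1` vertices between them would
agree with one of the two, giving one bead more than `D` such neighbours. So every bead has the
colour of the root, which then has `D + 1` neighbours of its own colour among the last beads. -/
theorem necklace_not_hasDefect (hr : 0 < r) (c : NecklaceVertex r D → Fin 2) :
    ¬ HasDefect (necklace r D hr) c D := by
  classical
  have := Fintype.ofFinite (NecklaceVertex r D)
  intro hc
  let mid : ∀ t < r, ∀ j ≤ D, Fin (2 * D + 1) → NecklaceVertex r D := fun t ht j hj m =>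
    ⟨(2 * t + 1, j, m), by have := m.2; simp only [IsNecklaceVertex]; omega⟩
  let bead : ∀ t ≤ r, ∀ j ≤ D, NecklaceVertex r D := fun t ht j hj =>
    ⟨(2 * t, if t = 0 then 0 else j, 0), 
      ⟨by dsimp only; omega, by dsimp only; split_ifs <;> omega, Nat.zero_le _, fun _ => rfl,
        fun h => if_pos (by dsimp only at h; omega)⟩⟩
  have hsame : ∀ t (ht : t < r) j (hj : j ≤ D),
      c (bead t ht.le j hj) = c (bead (t + 1) ht j hj) := by
    intro t ht j hj
    by_contra hne
    have hcol : ∀ x y z : Fin 2, x ≠ y → z = x ∨ z = y := by decide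
    have hinj : Function.Injective (mid t ht j hj) := by
      intro m m' h
      simp only [mid, Subtype.mk.injEq, Prod.mk.injEq, true_and] at h
      exact Fin.ext h
    have hsub : Set.range (mid t ht j hj) ⊆
        {w | (necklace r D hr).Adj (bead t ht.le j hj) w ∧ c w = c (bead t ht.le j hj)} ∪
        {w | (necklace r D hr).Adj (bead (t + 1) ht j hj) w ∧
          c w = c (bead (t + 1) ht j hj)} := by
      rintro _ ⟨m, rfl⟩
      rcases hcol _ _ (c (mid t ht j hj m)) hne with h | h
      · refine .inl ⟨.inl (.inl ⟨rfl, ?_⟩), h⟩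
        by_cases ht0 : t = 0
        · exact .inl (by simp [bead, ht0])
        · exact .inr (by simp [bead, mid, ht0])
      · exact .inr ⟨.inr (.inl ⟨by simp only [bead, mid]; omega,
          .inr (by simp [bead, mid])⟩), h⟩
    have h1 := (Set.ncard_le_ncard hsub (Set.toFinite _)).trans (Set.ncard_union_le _ _)
    rw [← Set.image_univ, Set.ncard_image_of_injective _ hinj, Set.ncard_univ,
      Nat.card_eq_fintype_card, Fintype.card_fin] at h1
    have h2 := hc (bead t ht.le j hj)
    have h3 := hc (bead (t + 1) ht j hj)
    omega
  have hall : ∀ t (ht : t ≤ r) j (hj : j ≤ D), c (bead t ht j hj) =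
      c (bead 0 (Nat.zero_le _) 0 (Nat.zero_le _)) := by
    intro t
    induction t with
    | zero => intro ht j hj; simp [bead]
    | succ t ih => intro ht j hj; rw [← hsame t ht j hj]; exact ih (by omega) j hj
  let last : Fin (D + 1) → NecklaceVertex r D := fun j =>
    bead r le_rfl j (Nat.lt_succ_iff.1 j.2)
  have hinj : Function.Injective last := by
    intro j j' h
    simp only [last, bead, hr.ne', if_false, Subtype.mk.injEq, Prod.mk.injEq, true_and,
      and_true] at h
    exact Fin.ext h
  have hsub : Set.range last ⊆ {w | (necklace r D hr).Adj
      (bead 0 (Nat.zero_le _) 0 (Nat.zero_le _)) w ∧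
      c w = c (bead 0 (Nat.zero_le _) 0 (Nat.zero_le _))} := by
    rintro _ ⟨j, rfl⟩
    exact ⟨.inl (.inr ⟨rfl, rfl⟩), hall r le_rfl j (Nat.lt_succ_iff.1 j.2)⟩
  have h1 := Set.ncard_le_ncard hsub (Set.toFinite _)
  rw [← Set.image_univ, Set.ncard_image_of_injective _ hinj, Set.ncard_univ,
    Nat.card_eq_fintype_card, Fintype.card_fin] at h1
  have h2 := hc (bead 0 (Nat.zero_le _) 0 (Nat.zero_le _))
  omega

end Necklace

/-! #### The necklace graph is planar -/

/-- The part over `[lo, hi]` of the graph of the piecewise linear function with values `Y`. -/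
def strandArc (Y : ℕ → ℝ) (lo hi : ℕ) : Set Plane :=
  {z | ∃ (c : ℕ) (θ : ℝ), lo ≤ c ∧ c < hi ∧ 0 ≤ θ ∧ θ ≤ 1 ∧
    z = ((c : ℝ) + θ, (1 - θ) * Y c + θ * Y (c + 1))}

theorem mem_segment_columns {Y : ℕ → ℝ} {c : ℕ} {z : Plane} :
    z ∈ segment ℝ ((c : ℝ), Y c) (((c + 1 : ℕ) : ℝ), Y (c + 1)) ↔
      ∃ θ : ℝ, 0 ≤ θ ∧ θ ≤ 1 ∧ z = ((c : ℝ) + θ, (1 - θ) * Y c + θ * Y (c + 1)) := by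
  rw [segment_eq_image]
  constructor
  · rintro ⟨θ, ⟨h0, h1⟩, rfl⟩
    refine ⟨θ, h0, h1, ?_⟩
    ext
    · simp; ring
    · simp
  · rintro ⟨θ, h0, h1, rfl⟩
    refine ⟨θ, ⟨h0, h1⟩, ?_⟩
    ext
    · simp; ring
    · simp

theorem isPolygonalArc_strandArc (Y : ℕ → ℝ) {lo hi : ℕ} (h : lo < hi) :
    IsPolygonalArc (strandArc Y lo hi) ((lo : ℝ), Y lo) ((hi : ℝ), Y hi) := by
  have hseg : ∀ {i : ℕ} {z : Plane}, z ∈ segment ℝ (((lo + i : ℕ) : ℝ), Y (lo + i))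
      (((lo + (i + 1) : ℕ) : ℝ), Y (lo + (i + 1))) ↔ ∃ θ : ℝ, 0 ≤ θ ∧ θ ≤ 1 ∧
        z = (((lo + i : ℕ) : ℝ) + θ, (1 - θ) * Y (lo + i) + θ * Y (lo + i + 1)) :=
    mem_segment_columns
  have hx : ∀ {i : ℕ} {z : Plane}, z ∈ segment ℝ (((lo + i : ℕ) : ℝ), Y (lo + i))
      (((lo + (i + 1) : ℕ) : ℝ), Y (lo + (i + 1))) →
        ((lo + i : ℕ) : ℝ) ≤ z.1 ∧ z.1 ≤ ((lo + i : ℕ) : ℝ) + 1 := by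
    intro i z hz
    obtain ⟨θ, h0, h1, rfl⟩ := hseg.1 hz
    constructor <;> dsimp only <;> linarith
  refine ⟨hi - lo - 1, fun k => (((lo + k : ℕ) : ℝ), Y (lo + k)), by simp, ?_, ?_, ?_, ?_, ?_⟩
  · simp only [show lo + (hi - lo - 1 + 1) = hi by omega]
  · ext z
    simp only [Set.mem_iUnion, hseg, Set.mem_Iic]
    constructor
    · rintro ⟨c, θ, h1, h2, h3, h4, rfl⟩
      refine ⟨c - lo, by omega, θ, h3, h4, ?_⟩
      rw [Nat.add_sub_cancel' h1]
    · rintro ⟨i, hi', θ, h3, h4, rfl⟩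
      exact ⟨lo + i, θ, by omega, by omega, h3, h4, rfl⟩
  · intro i _ hq
    have := congrArg Prod.fst hq
    simp only [Nat.cast_inj] at this
    omega
  · intro i _
    refine Set.Subset.antisymm ?_ ?_
    · rintro z ⟨h1, h2⟩
      obtain ⟨θ, -, -, hz⟩ := hseg.1 h1
      have hx1 := (hx h1).2
      have hx2 := (hx h2).1
      have hz1 : z.1 = ((lo + i : ℕ) : ℝ) + θ := by rw [hz]
      push_cast at hx1 hx2 hz1
      obtain rfl : θ = 1 := by linarith
      rw [Set.mem_singleton_iff, hz]
      ext
      · push_cast; ring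
      · simp [add_assoc]
    · rintro z rfl
      exact ⟨right_mem_segment ℝ _ _, left_mem_segment ℝ _ _⟩
  · intro i j hij _
    rw [Set.disjoint_left]
    intro z h1 h2
    have hx1 := (hx h1).2
    have hx2 := (hx h2).1
    have : ((i + 1 : ℕ) : ℝ) < j := by exact_mod_cast hij
    push_cast at hx1 hx2 this
    linarith

/-- A point of the curve in an integral column is a corner. -/
theorem eq_corner_of_mem_strandArc {Y : ℕ → ℝ} {lo hi e : ℕ} {z : Plane}
    (hz : z ∈ strandArc Y lo hi) (he : z.1 = e) : lo ≤ e ∧ e ≤ hi ∧ z.2 = Y e := by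
  obtain ⟨c, θ, h1, h2, h3, h4, rfl⟩ := hz
  dsimp only at he
  have a1 : c ≤ e := by
    have : (c : ℝ) ≤ e := by linarith
    exact_mod_cast this
  have a2 : e ≤ c + 1 := by
    have : (e : ℝ) ≤ ((c + 1 : ℕ) : ℝ) := by push_cast; linarith
    exact_mod_cast this
  refine ⟨by omega, by omega, ?_⟩
  rcases Nat.lt_or_ge c e with h | h
  · obtain rfl : e = c + 1 := by omega
    push_cast at he
    obtain rfl : θ = 1 := by linarith
    simp
  · obtain rfl : e = c := by omega
    obtain rfl : θ = 0 := by linarith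
    simp

/-- Curves that lie above each other, strictly at odd columns, meet only in even columns. -/
theorem exists_even_of_mem_strandArc {Y Y' : ℕ → ℝ} {lo hi lo' hi' : ℕ} {z : Plane}
    (hz : z ∈ strandArc Y lo hi) (hz' : z ∈ strandArc Y' lo' hi')
    (hle : ∀ c ≤ hi, Y c ≤ Y' c) (hlt : ∀ c ≤ hi, c % 2 = 1 → Y c < Y' c) :
    ∃ e : ℕ, e % 2 = 0 ∧ z.1 = e := by
  by_cases hint : ∃ e : ℕ, z.1 = e
  · obtain ⟨e, he⟩ := hint
    refine ⟨e, ?_, he⟩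
    obtain ⟨-, h2, h3⟩ := eq_corner_of_mem_strandArc hz he
    obtain ⟨-, -, h6⟩ := eq_corner_of_mem_strandArc hz' he
    by_contra hodd
    have := hlt e h2 (by omega)
    linarith
  · exfalso
    obtain ⟨c, θ, h1, h2, h3, h4, rfl⟩ := hz
    obtain ⟨c', θ', -, -, h3', h4', h⟩ := hz'
    push Not at hint
    have e1 := congrArg Prod.fst h
    have e2 := congrArg Prod.snd h
    dsimp only at e1 e2 hint
    have hθ0 : θ ≠ 0 := fun h => hint c (by rw [h, add_zero])
    have hθ1 : θ ≠ 1 := fun h => hint (c + 1) (by rw [h]; push_cast; ring)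
    have b0 : 0 < θ := lt_of_le_of_ne h3 (Ne.symm hθ0)
    have b1 : θ < 1 := lt_of_le_of_ne h4 hθ1
    have hcc : c = c' := by
      have x1 : c < c' + 1 := by
        have : (c : ℝ) < ((c' + 1 : ℕ) : ℝ) := by push_cast; linarith
        exact_mod_cast this
      have x2 : c' < c + 1 := by
        have : (c' : ℝ) < ((c + 1 : ℕ) : ℝ) := by push_cast; linarith
        exact_mod_cast this
      omega
    subst hcc
    obtain rfl : θ = θ' := by linarith
    have l1 := hle c h2.le
    have l2 := hle (c + 1) h2
    have b2 : 0 < 1 - θ := by linarith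
    -- Exactly one of the columns `c` and `c + 1` is odd; its strict inequality has positive weight
    -- because `0 < θ < 1`.
    rcases Nat.mod_two_eq_zero_or_one c with hc | hc
    · have := hlt (c + 1) h2 (by omega)
      have m1 := mul_le_mul_of_nonneg_left l1 b2.le
      have m2 := mul_lt_mul_of_pos_left this b0
      linarith
    · have := hlt c h2.le hc
      have m1 := mul_lt_mul_of_pos_left this b2
      have m2 := mul_le_mul_of_nonneg_left l2 b0.le
      linarith

section Necklace

variable {r D : ℕ}

/-- The height at column `c` of the thread `(j, m)`. The threads with `m = 2 * D + 1` carry the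
edges that close up the strands. -/
def threadHeight (r D j m c : ℕ) : ℕ :=
  if c = 0 then 0 else if c % 2 = 1 then j * (2 * D + 2) + m
    else if c = 2 * r ∨ m ≠ 2 * D + 1 then j * (2 * D + 2) else j * (2 * D + 2) + m

theorem mul_add_unique {N j m j' m' : ℕ} (hm : m < N) (hm' : m' < N)
    (h : j * N + m = j' * N + m') : j = j' ∧ m = m' := by
  have hN : 0 < N := by omega
  have h1 : (m + N * j) / N = (m' + N * j') / N := by rw [mul_comm N, mul_comm N]; congr 1; omega
  rw [Nat.add_mul_div_left _ _ hN, Nat.add_mul_div_left _ _ hN, Nat.div_eq_of_lt hm,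
    Nat.div_eq_of_lt hm'] at h1
  have : j = j' := by omega
  subst this
  exact ⟨rfl, by omega⟩

/-- Strands occupy bands of width `2 * D + 2`, which exceeds every offset `m`, so lexicographic
order of threads is vertical order. -/
theorem threadHeight_mono {j m j' m' : ℕ} (hm : m ≤ 2 * D + 1) (hm' : m' ≤ 2 * D + 1)
    (hlex : j < j' ∨ (j = j' ∧ m < m')) (c : ℕ) :
    threadHeight r D j m c ≤ threadHeight r D j' m' c ∧
      (c % 2 = 1 → threadHeight r D j m c < threadHeight r D j' m' c) := by
  have hmul : j < j' → j * (2 * D + 2) + (2 * D + 2) ≤ j' * (2 * D + 2) := by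
    intro h
    calc j * (2 * D + 2) + (2 * D + 2) = (j + 1) * (2 * D + 2) := by ring
      _ ≤ j' * (2 * D + 2) := Nat.mul_le_mul_right _ h
  have hmul' : j = j' → j * (2 * D + 2) = j' * (2 * D + 2) := fun h => by rw [h]
  unfold threadHeight
  generalize j * (2 * D + 2) = x at *
  generalize j' * (2 * D + 2) = y at *
  constructor
  · split_ifs <;> omega
  · intro _
    split_ifs <;> omega

/-- The position of a vertex of the necklace graph. -/
def necklacePoint (v : NecklaceVertex r D) : Plane :=
  ((v.1.1 : ℝ), ((v.1.2.1 * (2 * D + 2) + v.1.2.2 : ℕ) : ℝ))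

theorem necklacePoint_injective : Function.Injective (necklacePoint (r := r) (D := D)) := by
  intro u v h
  have h1 := congrArg Prod.fst h
  have h2 := congrArg Prod.snd h
  simp only [necklacePoint, Nat.cast_inj] at h1 h2
  have hu := u.2.2.2.1
  have hv := v.2.2.2.1
  obtain ⟨h3, h4⟩ := mul_add_unique (by omega) (by omega) h2
  exact NecklaceVertex.ext' h1 h3 h4

/-- The position within its strand of the thread of an edge. -/
def threadIndex (u v : NecklaceVertex r D) : ℕ :=
  if v.1.1 = u.1.1 + 1 then u.1.2.2 + v.1.2.2 else 2 * D + 1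

/-- The heights of the curve that represents an edge. -/
def edgeHeight (u v : NecklaceVertex r D) (c : ℕ) : ℝ :=
  (threadHeight r D v.1.2.1 (threadIndex u v) c : ℝ)

theorem Forward.lt (hr : 0 < r) {u v : NecklaceVertex r D} (h : Forward u v) :
    u.1.1 < v.1.1 := by
  simp only [Forward, StepUp, ClosesUp] at h
  omega

/-- One end of an ordinary step has last coordinate 0, so the sum in `threadIndex` is the index of
the middle vertex. The index `2 * D + 1` is reserved for closing edges. -/
theorem Forward.cases {u v : NecklaceVertex r D} (h : Forward u v) :
    (v.1.1 = u.1.1 + 1 ∧ (u.1.1 = 0 ∨ u.1.2.1 = v.1.2.1) ∧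
      threadIndex u v = u.1.2.2 + v.1.2.2 ∧ threadIndex u v ≤ 2 * D) ∨
    (u.1.1 = 0 ∧ v.1.1 = 2 * r ∧ threadIndex u v = 2 * D + 1) := by
  have hu := u.2
  have hv := v.2
  simp only [Forward, StepUp, ClosesUp, IsNecklaceVertex, threadIndex] at *
  rcases h with h | h
  · left
    rw [if_pos h.1]
    omega
  · right
    rw [if_neg (by omega)]
    omega

theorem Forward.threadIndex_le {u v : NecklaceVertex r D} (h : Forward u v) :
    threadIndex u v ≤ 2 * D + 1 := by
  rcases h.cases with h | h <;> omega

theorem Forward.necklacePoint_left {u v : NecklaceVertex r D} (h : Forward u v) :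
    necklacePoint u = ((u.1.1 : ℝ), edgeHeight u v u.1.1) := by
  refine Prod.ext rfl ?_
  simp only [necklacePoint, edgeHeight, Nat.cast_inj]
  have hu := u.2
  have hv := v.2
  simp only [IsNecklaceVertex] at hu hv
  by_cases h0 : u.1.1 = 0
  · rw [hu.2.2.2.2 h0, hu.2.2.2.1 (by omega), threadHeight, if_pos h0]
    simp
  · rcases h.cases with h | h
    · have hj : u.1.2.1 = v.1.2.1 := h.2.1.resolve_left h0
      unfold threadHeight
      rw [hj]
      generalize v.1.2.1 * (2 * D + 2) = x
      split_ifs <;> omega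
    · omega

theorem Forward.necklacePoint_right (hr : 0 < r) {u v : NecklaceVertex r D} (h : Forward u v) :
    necklacePoint v = ((v.1.1 : ℝ), edgeHeight u v v.1.1) := by
  refine Prod.ext rfl ?_
  simp only [necklacePoint, edgeHeight, Nat.cast_inj]
  have hu := u.2
  have hv := v.2
  simp only [IsNecklaceVertex] at hu hv
  have hlt := h.lt hr
  have hc := h.cases
  unfold threadHeight
  generalize v.1.2.1 * (2 * D + 2) = x
  split_ifs <;> omega

/-- The curve that represents an edge of the necklace graph. -/
def necklaceArc (e : Sym2 (NecklaceVertex r D)) : Set Plane :=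
  {z | ∃ u v, e = s(u, v) ∧ Forward u v ∧ z ∈ strandArc (edgeHeight u v) u.1.1 v.1.1}

theorem necklaceArc_eq (hr : 0 < r) {u v : NecklaceVertex r D} (h : Forward u v) :
    necklaceArc s(u, v) = strandArc (edgeHeight u v) u.1.1 v.1.1 := by
  ext z
  constructor
  · rintro ⟨u', v', he, h', hz⟩
    rcases Sym2.eq_iff.1 he with ⟨rfl, rfl⟩ | ⟨rfl, rfl⟩
    · exact hz
    · have := h.lt hr
      have := h'.lt hr
      omega
  · exact fun hz => ⟨u, v, rfl, h, hz⟩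

theorem IsPolygonalArc.symm {A : Set Plane} {x y : Plane} (h : IsPolygonalArc A x y) :
    IsPolygonalArc A y x := by
  obtain ⟨n, q, h0, hn, hA, hne, hcons, hdis⟩ := h
  have hs : ∀ i ≤ n, segment ℝ (q (n + 1 - i)) (q (n + 1 - (i + 1))) =
      segment ℝ (q (n - i)) (q (n - i + 1)) := by
    intro i hi
    rw [segment_symm, show n + 1 - (i + 1) = n - i by omega,
      show n + 1 - i = n - i + 1 by omega]
  refine ⟨n, fun i => q (n + 1 - i), by simpa using hn, by simpa using h0, ?_, ?_, ?_, ?_⟩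
  · rw [hA]
    ext z
    simp only [Set.mem_iUnion, Set.mem_Iic]
    constructor
    · rintro ⟨i, hi, hz⟩
      refine ⟨n - i, by omega, ?_⟩
      rw [hs _ (by omega), show n - (n - i) = i by omega]
      exact hz
    · rintro ⟨i, hi, hz⟩
      rw [hs i hi] at hz
      exact ⟨n - i, by omega, hz⟩
  · intro i hi
    have := (hne (n - i) (by omega)).symm
    rwa [show n - i + 1 = n + 1 - i by omega, show n - i = n + 1 - (i + 1) by omega] at this
  · intro i hi
    have := hcons (n - i - 1) (by omega)
    rw [Set.inter_comm] at this
    rw [hs i (by omega), hs (i + 1) (by omega)]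
    rw [show n - i - 1 + 1 = n - i by omega, show n - i - 1 + 2 = n - i + 1 by omega,
      show n - i - 1 = n - (i + 1) by omega] at this
    simp only [show n + 1 - (i + 1) = n - i by omega, show n - (i + 1) + 1 = n - i by omega]
    exact this
  · intro i j hij hj
    rw [hs i (by omega), hs j hj]
    exact (hdis (n - j) (n - i) (by omega) (by omega)).symm

/-- In an even column, the height of a thread determines whether it closes up a strand. -/
theorem threadHeight_closing {j j' m' e : ℕ} (hm' : m' ≤ 2 * D + 1) (h0 : e ≠ 0)
    (h1 : e ≠ 2 * r) (h : threadHeight r D j (2 * D + 1) e = threadHeight r D j' m' e) :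
    j' = j ∧ m' = 2 * D + 1 := by
  have hl : threadHeight r D j (2 * D + 1) e = j * (2 * D + 2) + (2 * D + 1) := by
    unfold threadHeight
    generalize j * (2 * D + 2) = x
    split_ifs <;> omega
  have hr' : threadHeight r D j' m' e = j' * (2 * D + 2) + m' ∨
      threadHeight r D j' m' e = j' * (2 * D + 2) + 0 := by
    unfold threadHeight
    generalize j' * (2 * D + 2) = x
    split_ifs <;> omega
  rw [hl] at h
  rcases hr' with h' | h' <;> rw [h'] at h
  · obtain ⟨a, b⟩ := mul_add_unique (by omega) (by omega) h
    exact ⟨a.symm, b.symm⟩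
  · obtain ⟨-, b⟩ := mul_add_unique (by omega) (by omega) h
    omega

/-- A corner of the curve of an edge that has the height of another thread is an end. -/
theorem Forward.corner_eq_end (hr : 0 < r) {u v : NecklaceVertex r D} (h : Forward u v)
    {z : Plane} (hz : z ∈ strandArc (edgeHeight u v) u.1.1 v.1.1) {e j' m' : ℕ} (he : z.1 = e)
    (hm' : m' ≤ 2 * D + 1) (hother : (v.1.2.1, threadIndex u v) ≠ (j', m') ∨ m' ≠ 2 * D + 1)
    (hh : z.2 = (threadHeight r D j' m' e : ℝ)) : z = necklacePoint u ∨ z = necklacePoint v := by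
  obtain ⟨h1, h2, h3⟩ := eq_corner_of_mem_strandArc hz he
  have hend : e = u.1.1 ∨ e = v.1.1 := by
    rcases h.cases with h | ⟨hu, hv, ht⟩
    · omega
    · by_contra! hne
      rw [h3, edgeHeight, Nat.cast_inj, ht] at hh
      obtain ⟨a, b⟩ := threadHeight_closing hm' (by omega) (by omega) hh
      rcases hother with h | h
      · exact h (by rw [ht, a, b])
      · exact h b
  rcases hend with rfl | rfl
  · left
    rw [h.necklacePoint_left]
    exact Prod.ext he h3
  · right
    rw [h.necklacePoint_right hr]
    exact Prod.ext he h3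

/-- Distinct edges of one thread occupy different unit columns, so they can meet only over an
integer. Different threads meet only over even columns, where an ordinary edge has an end and an
inner corner of a closing edge has a height shared with no other thread. -/
theorem Forward.eq_end_of_mem_inter (hr : 0 < r) {u v u' v' : NecklaceVertex r D}
    (h : Forward u v) (h' : Forward u' v') (hne : s(u, v) ≠ s(u', v')) {z : Plane}
    (hz : z ∈ strandArc (edgeHeight u v) u.1.1 v.1.1)
    (hz' : z ∈ strandArc (edgeHeight u' v') u'.1.1 v'.1.1) :
    z = necklacePoint u ∨ z = necklacePoint v := by
  have hm := h.threadIndex_le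
  have hm' := h'.threadIndex_le
  by_cases hsame : (v.1.2.1, threadIndex u v) = (v'.1.2.1, threadIndex u' v')
  · obtain ⟨hj, ht⟩ := Prod.mk.inj hsame
    have hu := u.2
    have hv := v.2
    have hu' := u'.2
    have hv' := v'.2
    simp only [IsNecklaceVertex] at hu hv hu' hv'
    have hcol : u.1.1 ≠ u'.1.1 ∧ v.1.1 = u.1.1 + 1 ∧ v'.1.1 = u'.1.1 + 1 := by
      rcases h.cases with ⟨c1, c2, c3, c4⟩ | ⟨c1, c2, c3⟩ <;>
      rcases h'.cases with ⟨c1', c2', c3', c4'⟩ | ⟨c1', c2', c3'⟩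
      · refine ⟨fun hc => hne ?_, c1, c1'⟩
        have e1 : u = u' := NecklaceVertex.ext' hc (by omega) (by omega)
        have e2 : v = v' := NecklaceVertex.ext' (by omega) hj (by omega)
        rw [e1, e2]
      · omega
      · omega
      · exfalso
        have e1 : u = u' := NecklaceVertex.ext' (by omega) (by omega) (by omega)
        have e2 : v = v' := NecklaceVertex.ext' (by omega) hj (by omega)
        exact hne (by rw [e1, e2])
    obtain ⟨c, θ, a1, a2, a3, a4, hz1⟩ := id hz
    obtain ⟨c', θ', b1, b2, b3, b4, hz2⟩ := id hz'
    obtain rfl : c = u.1.1 := by omega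
    obtain rfl : c' = u'.1.1 := by omega
    have hx1 : z.1 = (u.1.1 : ℝ) + θ := by rw [hz1]
    have hx2 : z.1 = (u'.1.1 : ℝ) + θ' := by rw [hz2]
    have hint : ∃ e : ℕ, z.1 = e := by
      rcases lt_or_gt_of_ne hcol.1 with hlt | hlt
      · have : ((u.1.1 + 1 : ℕ) : ℝ) ≤ u'.1.1 := by exact_mod_cast hlt
        push_cast at this
        exact ⟨u'.1.1, by linarith⟩
      · have : ((u'.1.1 + 1 : ℕ) : ℝ) ≤ u.1.1 := by exact_mod_cast hlt
        push_cast at this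
        exact ⟨u.1.1, by linarith⟩
    obtain ⟨e, he⟩ := hint
    obtain ⟨p1, p2, p3⟩ := eq_corner_of_mem_strandArc hz he
    have hend : e = u.1.1 ∨ e = v.1.1 := by omega
    rcases hend with rfl | rfl
    · left
      rw [h.necklacePoint_left]
      exact Prod.ext he p3
    · right
      rw [h.necklacePoint_right hr]
      exact Prod.ext he p3
  · have heven : ∃ e : ℕ, e % 2 = 0 ∧ z.1 = e := by
      have hlex : (v.1.2.1 < v'.1.2.1 ∨ (v.1.2.1 = v'.1.2.1 ∧ threadIndex u v < threadIndex u' v'))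
          ∨ (v'.1.2.1 < v.1.2.1 ∨ (v'.1.2.1 = v.1.2.1 ∧ threadIndex u' v' < threadIndex u v)) := by
        rw [Prod.mk.injEq] at hsame
        omega
      rcases hlex with hlex | hlex
      · exact exists_even_of_mem_strandArc hz hz'
          (fun c _ => Nat.cast_le.2 (threadHeight_mono hm hm' hlex c).1)
          (fun c _ hc => Nat.cast_lt.2 ((threadHeight_mono hm hm' hlex c).2 hc))
      · exact exists_even_of_mem_strandArc hz' hz
          (fun c _ => Nat.cast_le.2 (threadHeight_mono hm' hm hlex c).1)
          (fun c _ hc => Nat.cast_lt.2 ((threadHeight_mono hm' hm hlex c).2 hc))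
    obtain ⟨e, -, he⟩ := heven
    exact h.corner_eq_end hr hz he hm' (.inl hsame) (eq_corner_of_mem_strandArc hz' he).2.2

theorem isPlanar_necklace (hr : 0 < r) : IsPlanar (necklace r D hr) := by
  have hform : ∀ e ∈ (necklace r D hr).edgeSet, ∃ u v, e = s(u, v) ∧ Forward u v := by
    intro e he
    induction e with
    | _ a b =>
      rcases he with h | h
      · exact ⟨a, b, rfl, h⟩
      · exact ⟨b, a, Sym2.eq_swap, h⟩
  refine ⟨⟨necklacePoint, necklacePoint_injective, necklaceArc, ?_, ?_, ?_⟩⟩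
  · intro u v huv
    have main : ∀ {u v : NecklaceVertex r D}, Forward u v →
        IsPolygonalArc (necklaceArc s(u, v)) (necklacePoint u) (necklacePoint v) := by
      intro u v h
      rw [necklaceArc_eq hr h, h.necklacePoint_left, h.necklacePoint_right hr]
      exact isPolygonalArc_strandArc _ (h.lt hr)
    rcases huv with h | h
    · exact main h
    · rw [Sym2.eq_swap]
      exact (main h).symm
  · intro e he
    obtain ⟨u, v, rfl, h⟩ := hform e he
    rw [necklaceArc_eq hr h, Set.disjoint_left]
    rintro _ ⟨hz, hend⟩ ⟨w, rfl⟩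
    have hw := w.2
    simp only [IsNecklaceVertex] at hw
    -- The vertex is a corner of the thread with its own indices, which is not a closing thread
    -- since the last coordinate is at most `2 * D`.
    have hh : (necklacePoint w).2 =
        (threadHeight r D w.1.2.1 w.1.2.2 w.1.1 : ℝ) := by
      simp only [necklacePoint, Nat.cast_inj]
      by_cases h0 : w.1.1 = 0
      · rw [hw.2.2.2.2 h0, hw.2.2.2.1 (by omega), threadHeight, if_pos h0]
        simp
      · unfold threadHeight
        generalize w.1.2.1 * (2 * D + 2) = x
        split_ifs <;> omega
    rcases h.corner_eq_end hr hz rfl (by omega : w.1.2.2 ≤ 2 * D + 1) (.inr (by omega)) hh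
      with h | h
    · exact hend ⟨u, by simp, h.symm⟩
    · exact hend ⟨v, by simp, h.symm⟩
  · intro e he f hf hef
    obtain ⟨u, v, rfl, h⟩ := hform e he
    obtain ⟨u', v', rfl, h'⟩ := hform f hf
    rw [necklaceArc_eq hr h, necklaceArc_eq hr h', Set.disjoint_left]
    rintro z ⟨hz, hend⟩ hz'
    rcases h.eq_end_of_mem_inter hr h' hef hz hz' with h | h
    · exact hend ⟨u, by simp, h.symm⟩
    · exact hend ⟨v, by simp, h.symm⟩

end Necklace

/-! ### The characterization -/

theorem isBalancedObstructionSet_iff (S : Set CycleLength) :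
    IsBalancedObstructionSet 2 S ↔ fourCycle ∈ S ∨ oddCycles ⊆ S := by
  constructor
  · rintro ⟨D, hD⟩
    by_contra! hcon
    obtain ⟨h4, hodd⟩ := hcon
    -- The missing odd cycle fixes the number `r` of pieces per strand, and the supposed defect `D`
    -- fixes the number and thickness of the strands.
    obtain ⟨⟨k, hk⟩, ⟨r, hkr⟩, hkS⟩ := Set.not_subset.1 hodd
    dsimp only at hkr
    have hr : 0 < r := by omega
    have hG := hD _ (necklace r D hr) ⟨isPlanar_necklace hr, fun l hl hcont => ?_⟩
    · obtain ⟨c, hc⟩ := isDefectiveColorable_iff.1 hG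
      exact necklace_not_hasDefect hr c hc
    · rcases necklace_cycle_length l.2 hcont with h | h
      · exact h4 ((Subtype.ext h : l = fourCycle) ▸ hl)
      · exact hkS ((Subtype.ext (h.trans hkr.symm) : l = ⟨k, hk⟩) ▸ hl)
  · rintro (h | h)
    · exact isBalancedObstructionSet_of_fourCycle_mem h
    · exact isBalancedObstructionSet_of_oddCycles_subset h

theorem fourCycle_notMem_oddCycles : fourCycle ∉ oddCycles := by
  intro h
  have h : Odd 4 := h
  exact absurd h (by decide)

theorem not_oddCycles_subset_singleton : ¬ oddCycles ⊆ {fourCycle} := by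
  intro h
  have h3 : (⟨3, le_rfl⟩ : CycleLength) ∈ oddCycles := by
    change Odd 3
    decide
  have := congrArg Subtype.val (h h3)
  simp [fourCycle] at this

end ImproperColoring

open ImproperColoring in
theorem mainTheorem1 :
    (∀ S : Set CycleLength,
      IsBalancedObstructionSet 2 S ↔ fourCycle ∈ S ∨ oddCycles ⊆ S) ∧
    (∀ S : Set CycleLength,
      Minimal (IsBalancedObstructionSet 2) S ↔ S = {fourCycle} ∨ S = oddCycles) := by
  refine ⟨isBalancedObstructionSet_iff, fun S => ⟨fun h => ?_, ?_⟩⟩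
  · rcases (isBalancedObstructionSet_iff S).1 h.prop with h4 | hodd
    · left
      refine (h.eq_of_le ?_ (Set.singleton_subset_iff.2 h4)).symm
      exact isBalancedObstructionSet_of_fourCycle_mem (Set.mem_singleton _)
    · right
      exact (h.eq_of_le (isBalancedObstructionSet_of_oddCycles_subset subset_rfl) hodd).symm
  · rintro (rfl | rfl)
    · refine ⟨isBalancedObstructionSet_of_fourCycle_mem (Set.mem_singleton _), fun T hT hle => ?_⟩
      rcases (isBalancedObstructionSet_iff T).1 hT with h | h
      · exact Set.singleton_subset_iff.2 h
      · exact absurd (h.trans hle) not_oddCycles_subset_singleton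
    · refine ⟨isBalancedObstructionSet_of_oddCycles_subset subset_rfl, fun T hT hle => ?_⟩
      rcases (isBalancedObstructionSet_iff T).1 hT with h | h
      · exact absurd (hle h) fourCycle_notMem_oddCycles
      · exact h
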